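/- **Setting.** Let $M$ be a smooth 4-manifold and $U\to M$ a smooth complex vector bundle of rank 2 with a smooth Hermitian structure on $\Lambda^2U$; thus there are local normalised symplectic forms $\varepsilon$, unique up to a phase. Let $\bar U^\star$ be the anti-dual bundle and $H\subset U\otimes\bar U$ the real bundle of Hermitian elements, with the Lorentz metric $g(u\otimes\bar u,v\otimes\bar v)=|\varepsilon(u,v)|^2$. Let $\theta:TM\to H$ be a smooth non-degenerate tetrad, let $|\theta|=|\det(\theta_a^\lambda)|$ be its density (components in an orthonormal frame of $H$), and let $g_{ab}=g(\theta_a,\theta_b)$. Let $\nabla$ be a complex linear connection of $U$ preserving the Hermitian structure of $\Lambda^2U$, together with the connections it induces on associated bundles. Let $\Gamma_a{}^c{}_b$ be the connection of $TM$ for which $\theta$ is covariantly constant, $T^c{}_{ab}=\Gamma_a{}^c{}_b-\Gamma_b{}^c{}_a$ its torsion, i.e. $T(X,Y)=\nabla_XY-\nabla_YX-[X,Y]$, and $\breve T_a=T^b{}_{ab}$. For $r=2j\ge1$ put $$W^{\{r\}}=\bigoplus_{n=0}^{r-1}\bigl(\vee^{r-n}U\otimes\vee^{n}\bar U^\star\bigr)\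 \oplus\ \bigoplus_{n=0}^{r-1}\bigl(\vee^{r-n}\bar U^\star\otimes\vee^{n}U\bigr).$$ For $Y\in H$ the generalised Dirac map $\check\gamma[Y]\in\mathrm{End}\,W^{\{r\}}$ sends each summand to the next one in cyclic order (the last one of each family going to the first one of the other). It applies to the last factor of the first block the Dirac map, which is $u^A\mapsto\sqrt2\,Y_{A\dot B}u^A$ on $U$ and $\bar\lambda_{\dot A}\mapsto\sqrt2\,Y^{B\dot A}\bar\lambda_{\dot A}$ on $\bar U^\star$, and then symmetrises the new second block (with normalising factorials). It acts on the dual bundle by transposition. Put $\check\gamma^a=g^{ab}\check\gamma[\theta_b]$ and $\check\gamma[\breve T]=\breve T_a\check\gamma^a$. For smooth independent fields $\Psi:M\to W^{\{r\}}$ and $\bar\Psi:M\to(W^{\{r\}})^\star$ put $\check{\not\nabla}\Psi=\check\gamma^a\nabla_a\Psi$ and $\check{\not\nabla}\bar\Psi=(\nabla_a\bar\Psi)\,\check\gamma^a$. For real $m$ consider the Lagrangian density $\ell\,d^4x$ with $$\tfrac1{|\theta|}\,\ell=\tfrac i2\bigl(\langle\bar\Psi,\check{\not\nabla}\Psi\rangle-\langle\check{\not\nabla}\bar\Psi,\Psi\rangle\bigr)-m\,\langle\bar\Psi,\Psi\rangle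 .$$ **Claim.** In every chart of $M$ with a smooth frame $(z_1,z_2)$ of $U$ normalised by $\|z_1\wedge z_2\|=1$, and at every point of it, the following hold. 1. The Euler–Lagrange equations of $\ell$ with respect to $\bar\Psi$ and with respect to $\Psi$ are equivalent to, respectively, $$i\,\check{\not\nabla}\Psi-m\Psi+\tfrac i2\,\check\gamma[\breve T]\Psi=0,\qquad -i\,\check{\not\nabla}\bar\Psi-m\bar\Psi-\tfrac i2\,\bar\Psi\,\check\gamma[\breve T]=0 .$$ 2. Regarding $\Psi,\bar\Psi,\nabla\Psi,\nabla\bar\Psi$ as independent variables of $\ell$, one has $$\Pi^{(0)}=\tfrac{\partial\ell}{\partial\Psi}=|\theta|\bigl(-\tfrac i2\check{\not\nabla}\bar\Psi-m\bar\Psi\bigr),\qquad \Pi^{(1)a}=\tfrac{\partial\ell}{\partial\nabla_a\Psi}=\tfrac i2|\theta|\,\bar\Psi\check\gamma^a,$$ $$\bar\Pi^{(0)}=\tfrac{\partial\ell}{\partial\bar\Psi}=|\theta|\bigl(\tfrac i2\check{\not\nabla}\Psi-m\Psi\bigr),\qquad \bar\Pi^{(1)a}=\tfrac{\partial\ell}{\partial\nabla_a\bar\Psi}=-\tfrac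 i2|\theta|\,\check\gamma^a\Psi,$$ and the Euler–Lagrange expressions with respect to $\Psi$ and $\bar\Psi$ equal $\Pi^{(0)}-d_\Gamma\Pi^{(1)}$ and $\bar\Pi^{(0)}-d_\Gamma\bar\Pi^{(1)}$ (coefficients of $d^4x$). Here $d_\Gamma$ is the covariant exterior differential of the bundle-valued 3-forms $\Pi^{(1)a}\otimes dx_a$ and $\bar\Pi^{(1)a}\otimes dx_a$, with $dx_a=i(\partial_a)d^4x$. 3. The canonical energy tensor $\mathcal U^a{}_b=\ell\,\delta^a{}_b-\langle\tfrac{\partial\ell}{\partial\nabla_a\Psi},\nabla_b\Psi\rangle-\langle\tfrac{\partial\ell}{\partial\nabla_a\bar\Psi},\nabla_b\bar\Psi\rangle$ is $$\mathcal U^a{}_b=\ell\,\delta^a{}_b-\tfrac i2|\theta|\,\langle\bar\Psi\check\gamma^a,\nabla_b\Psi\rangle+\tfrac i2|\theta|\,\langle\nabla_b\bar\Psi,\check\gamma^a\Psi\rangle .$$ -/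

import Mathlib

open scoped Manifold ContDiff Matrix ComplexConjugate
open Bundle

noncomputable section

namespace HigherSpin

/-! ## Algebra of the model fibre -/

/-- The model of a four-dimensional spacetime. -/
abbrev Space := EuclideanSpace ℝ (Fin 4)

/-- Two-by-two complex matrices, used for components `Y^{A A'}` of elements of `U ⊗ Ū`
and for components `K^A_B` of endomorphisms of `U`. -/
abbrev Mat2 := Matrix (Fin 2) (Fin 2) ℂ

/-- The symbol `ε_{AB} = δ^1_A δ^2_B - δ^2_A δ^1_B`. -/
def eps : Mat2 := !![0, 1; -1, 0]

/-- Lowered components `Y_{B B'} = ε_{AB} ε_{A'B'} Y^{A A'}`. -/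
def lower (Y : Mat2) : Mat2 := epsᵀ * Y * eps

/-- The Lorentz metric `g(X, Y) = ε_{AB} ε_{A'B'} X^{A A'} Y^{B B'}` of Hermitian elements,
for which `g(u ⊗ ū, v ⊗ v̄) = |ε(u, v)|²`. -/
def lorentz (X Y : Mat2) : ℝ := (∑ B, ∑ B', lower X B B' * Y B B').re

/-- The Pauli matrices `σ_0, σ_1, σ_2, σ_3`. -/
def pauli : Fin 4 → Mat2 :=
  ![!![1, 0; 0, 1], !![0, 1; 1, 0], !![0, -Complex.I; Complex.I, 0], !![1, 0; 0, -1]]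

/-- The component `Y^l` of a Hermitian `Y = ∑ Y^l τ_l` in the orthonormal Pauli frame
`τ_l = σ_l / √2`. -/
def pauliComp (l : Fin 4) (Y : Mat2) : ℝ := ((pauli l * Y).trace).re / Real.sqrt 2

/-- The `2r` sectors of `W^{r}`. For `0 ≤ n < r` the sector `(false, n)` is
`U^(r-n,n) = ∨^{r-n} U ⊗ ∨^n Ū*`, the sector `(true, n)` is
`Ũ^(r-n,n) = ∨^{r-n} Ū* ⊗ ∨^n U`; here `Ū*` is the anti-dual of `U`. In particular
`(true, 0)` is `∨^r Ū* = U^(0,r)`. -/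
abbrev Sector (r : ℕ) := Bool × Fin r

/-- The type of the `i`-th tensor factor in a sector: `false` is `U` (an upper undotted index),
`true` is `Ū*` (a lower dotted index). -/
def slotType {r : ℕ} (k : Sector r) (i : Fin r) : Bool :=
  if (i : ℕ) < r - (k.2 : ℕ) then k.1 else !k.1

/-- The permutations of the tensor factors that preserve the two blocks of a sector. -/
def blockPerms {r : ℕ} (k : Sector r) : Subgroup (Equiv.Perm (Fin r)) where
  carrier := {s | ∀ i, slotType k (s i) = slotType k i}
  mul_mem' {s t} hs ht i := by
    change slotType k (s (t i)) = slotType k i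
    rw [hs, ht]
  one_mem' _ := rfl
  inv_mem' {s} hs i := by
    have h := hs (s⁻¹ i)
    rw [show s (s⁻¹ i) = i from s.apply_symm_apply i] at h
    exact h.symm

instance {r : ℕ} (k : Sector r) : Fintype (blockPerms k) := Fintype.ofFinite _

/-- All families of components, one array with `r` two-valued indices for each sector. -/
abbrev Comp (r : ℕ) := Sector r → (Fin r → Fin 2) → ℂ

/-- The model `W^{r}(ℂ²)` of the fibre of `W^{r}`: in every sector the components are symmetric
in the indices of the first block and in the indices of the second block. -/
def Model (r : ℕ) : Submodule ℂ (Comp r) where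
  carrier := {Φ | ∀ k, ∀ s ∈ blockPerms k, ∀ α : Fin r → Fin 2, Φ k (α ∘ s) = Φ k α}
  add_mem' {Φ Φ'} h h' k s hs α := by
    change Φ k _ + Φ' k _ = Φ k _ + Φ' k _
    rw [h k s hs, h' k s hs]
  zero_mem' _ _ _ _ := rfl
  smul_mem' c Φ h k s hs α := by
    change c * Φ k _ = c * Φ k _
    rw [h k s hs]

instance (r : ℕ) : NormedAddCommGroup (Model r) := Submodule.normedAddCommGroup _

instance (r : ℕ) : NormedSpace ℂ (Model r) := Submodule.normedSpace _

instance (r : ℕ) : NormedSpace ℝ (Model r) := Submodule.normedSpace _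

instance (r : ℕ) : FiniteDimensional ℂ (Model r) :=
  FiniteDimensional.finiteDimensional_submodule _

/-- The dual space of the model fibre. -/
abbrev ModelDual (r : ℕ) := Model r →L[ℂ] ℂ

/-- The action of a pair of matrices (one for undotted, one for dotted indices) on all indices. -/
def transformComp {r : ℕ} (P : Bool → Mat2) (Φ : Comp r) : Comp r := fun k α =>
  ∑ β : Fin r → Fin 2, (∏ i, P (slotType k i) (α i) (β i)) * Φ k β

theorem transformComp_mem {r : ℕ} (P : Bool → Mat2) {Φ : Comp r} (h : Φ ∈ Model r) :
    transformComp P Φ ∈ Model r := by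
  intro k s hs α
  unfold transformComp
  refine (Fintype.sum_equiv (Equiv.arrowCongr s.symm (Equiv.refl (Fin 2))) _ _ ?_).symm
  intro β
  have e : (Equiv.arrowCongr s.symm (Equiv.refl (Fin 2))) β = β ∘ s := rfl
  rw [e, h k s hs β]
  congr 1
  refine (Fintype.prod_equiv s _ _ ?_).symm
  intro i
  simp only [Function.comp_apply]
  rw [hs i]

/-- `transformComp` as a map of the model fibre. -/
def transform {r : ℕ} (P : Bool → Mat2) (w : Model r) : Model r :=
  ⟨transformComp P w, transformComp_mem P w.2⟩

/-- The action of an endomorphism `K` of `U` on the components of `W^{r}` by the Leibniz rule: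
`K` acts on upper undotted indices, `-K†` on lower dotted ones. -/
def actComp {r : ℕ} (K : Mat2) (Φ : Comp r) : Comp r := fun k α =>
  ∑ i, ∑ c, (bif slotType k i then -Kᴴ else K) (α i) c * Φ k (Function.update α i c)

theorem update_comp_perm {r : ℕ} (s : Equiv.Perm (Fin r)) (α : Fin r → Fin 2) (i : Fin r)
    (c : Fin 2) :
    Function.update (α ∘ s) i c = Function.update α (s i) c ∘ s := by
  funext j
  by_cases hj : j = i
  · subst hj
    simp
  · have : s j ≠ s i := fun h => hj (s.injective h)
    simp [Function.update_of_ne hj, Function.update_of_ne this]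

theorem actComp_mem {r : ℕ} (K : Mat2) {Φ : Comp r} (h : Φ ∈ Model r) :
    actComp K Φ ∈ Model r := by
  intro k s hs α
  unfold actComp
  refine Fintype.sum_equiv s _ _ ?_
  intro i
  refine Finset.sum_congr rfl ?_
  intro c _
  rw [update_comp_perm, h k s hs, hs i]
  rfl

/-- The Leibniz action of an endomorphism of `U` on the model fibre of `W^{r}`. -/
def act {r : ℕ} (K : Mat2) : Model r →L[ℂ] Model r :=
  LinearMap.toContinuousLinearMap
    { toFun := fun w => ⟨actComp K w, actComp_mem K w.2⟩
      map_add' := by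
        intro w w'
        apply Subtype.ext
        funext k α
        change actComp K (w + w' : Comp r) k α = actComp K w k α + actComp K w' k α
        simp only [actComp, Pi.add_apply, mul_add, Finset.sum_add_distrib]
      map_smul' := by
        intro z w
        apply Subtype.ext
        funext k α
        change actComp K (z • w : Comp r) k α = z * actComp K w k α
        simp only [actComp, Pi.smul_apply, smul_eq_mul, Finset.mul_sum, mul_left_comm] }

/-- Symmetrisation, with normalising factorials, in the two blocks of indices of a sector. -/
def symmetrise {r : ℕ} (k : Sector r) (f : (Fin r → Fin 2) → ℂ) : (Fin r → Fin 2) → ℂ :=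
  fun α => (Fintype.card (blockPerms k) : ℂ)⁻¹ * ∑ s : blockPerms k, f (α ∘ (s : Equiv.Perm (Fin r)))

/-- The sector that the generalised Dirac map sends to the sector `k`, in the cyclic sequence
`U^(r,0) → U^(r-1,1) → ⋯ → U^(1,r-1) → U^(0,r) = Ũ^(r,0) → Ũ^(r-1,1) → ⋯ → Ũ^(1,r-1) → U^(r,0)`. -/
def source {r : ℕ} (k : Sector r) : Sector r :=
  if (k.2 : ℕ) = 0 then (!k.1, ⟨r - 1, by have := k.2.2; omega⟩)
  else (k.1, ⟨(k.2 : ℕ) - 1, by have := k.2.2; omega⟩)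

/-- The last index of the first block of the sector `source k`. -/
def lastSlot {r : ℕ} (k : Sector r) : Fin r :=
  ⟨r - 1 - ((source k).2 : ℕ), by have := k.2.2; omega⟩

/-- The Dirac map `γ[Y]` on a single index: for an undotted source index it is
`u^A ↦ √2 Y_{A B'} u^A`, for a dotted one it is `λ_{A'} ↦ √2 Y^{B A'} λ_{A'}`. -/
def diracMatrix (t : Bool) (Y : Mat2) : Mat2 :=
  (Real.sqrt 2 : ℂ) • (bif t then Y else (lower Y)ᵀ)

/-- The generalised Dirac map in components: the Dirac map on the last index of the first block,
followed by symmetrisation. -/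
def gammaComp {r : ℕ} (Y : Mat2) (Φ : Comp r) : Comp r := fun k =>
  symmetrise k fun β =>
    ∑ c, diracMatrix (source k).1 Y (β (lastSlot k)) c *
      Φ (source k) (Function.update β (lastSlot k) c)

theorem gammaComp_mem {r : ℕ} (Y : Mat2) (Φ : Comp r) : gammaComp Y Φ ∈ Model r := by
  intro k s hs α
  unfold gammaComp symmetrise
  congr 1
  refine Fintype.sum_equiv (Equiv.mulLeft (⟨s, hs⟩ : blockPerms k)) _ _ ?_
  intro t
  rfl

theorem gammaComp_add {r : ℕ} (Y : Mat2) (Φ Φ' : Comp r) :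
    gammaComp Y (Φ + Φ') = gammaComp Y Φ + gammaComp Y Φ' := by
  funext k α
  simp only [gammaComp, symmetrise, Pi.add_apply, mul_add, Finset.sum_add_distrib]

theorem gammaComp_smul {r : ℕ} (Y : Mat2) (z : ℂ) (Φ : Comp r) :
    gammaComp Y (z • Φ) = z • gammaComp Y Φ := by
  funext k α
  simp only [gammaComp, symmetrise, Pi.smul_apply, smul_eq_mul, Finset.mul_sum, mul_left_comm]

/-- The generalised Dirac map `γ̌[Y] : W^{r} → W^{r}`. -/
def gammaCheck {r : ℕ} (Y : Mat2) : Model r →L[ℂ] Model r :=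
  LinearMap.toContinuousLinearMap
    { toFun := fun w => ⟨gammaComp Y (w : Comp r), gammaComp_mem Y (w : Comp r)⟩
      map_add' := fun w w' =>
        Subtype.ext (gammaComp_add Y (w : Comp r) (w' : Comp r))
      map_smul' := fun z w => Subtype.ext (gammaComp_smul Y z (w : Comp r)) }

/-! ## Local field theory in a coordinate chart and a spinor frame -/

/-- The coordinate derivative `∂_a f` at `y`. -/
def partialDeriv {F : Type*} [NormedAddCommGroup F] [NormedSpace ℝ F]
    (a : Fin 4) (f : Space → F) (y : Space) : F :=
  fderiv ℝ f y (EuclideanSpace.single a 1)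

/-- The Euler-Lagrange expression of a first-order Lagrangian `L(y, φ, ∂φ)`, evaluated at the
variation `η`: `(∂L/∂φ)(η) - ∑_a ∂_a ((∂L/∂(∂_a φ))(η))`. Complex derivatives are used with
respect to the complex field components. -/
def eulerLagrange {F : Type*} [NormedAddCommGroup F] [NormedSpace ℂ F] [NormedSpace ℝ F]
    (L : Space → F → (Fin 4 → F) → ℂ) (φ : Space → F) (y : Space) (η : F) : ℂ :=
  fderiv ℂ (fun w => L y w fun a => partialDeriv a φ y) (φ y) η -
    ∑ a, partialDeriv a
      (fun y' => fderiv ℂ (fun p => L y' (φ y') p) (fun b => partialDeriv b φ y')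
        (Pi.single a η)) y

/-- The components of a tetrad and of a two-spinor connection:
`tetrad y a = (θ_a^{A A'})`, `conn y a = (Γ_a^A_B)` with `∇_a u^A = ∂_a u^A + Γ_a^A_B u^B`. -/
structure LocalGeometry where
  tetrad : Space → Fin 4 → Mat2
  conn : Space → Fin 4 → Mat2

namespace LocalGeometry

/-- The matrix `θ_a^l` of the tetrad in the Pauli frame. -/
def tetradMatrix (g : LocalGeometry) (y : Space) : Matrix (Fin 4) (Fin 4) ℝ :=
  Matrix.of fun a l => pauliComp l (g.tetrad y a)

/-- The density `|θ|`. -/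
def vol (g : LocalGeometry) (y : Space) : ℝ := |(g.tetradMatrix y).det|

/-- The spacetime metric `g_{ab} = g(θ_a, θ_b)`. -/
def metric (g : LocalGeometry) (y : Space) : Matrix (Fin 4) (Fin 4) ℝ :=
  Matrix.of fun a b => lorentz (g.tetrad y a) (g.tetrad y b)

/-- `γ̌^a = g^{ab} γ̌[θ_b]`. -/
def gammaUp (g : LocalGeometry) {r : ℕ} (y : Space) (a : Fin 4) : Model r →L[ℂ] Model r :=
  ∑ b, (((g.metric y)⁻¹ a b : ℝ) : ℂ) • gammaCheck (r := r) (g.tetrad y b)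

/-- The covariant derivative of `θ_b`, with respect to the induced connection of
`H ⊂ U ⊗ Ū` only:
`∂_a θ_b^{A A'} + Γ_a^A_B θ_b^{B A'} + conj(Γ_a^{A'}_{B'}) θ_b^{A B'}`. -/
def spinDerivTetrad (g : LocalGeometry) (y : Space) (a b : Fin 4) : Mat2 :=
  Matrix.of (fun A A' => partialDeriv a (fun y' => g.tetrad y' b A A') y) +
    g.conn y a * g.tetrad y b + g.tetrad y b * (g.conn y a)ᴴ

/-- The coefficients `Γ_a^c_b` of the spacetime connection determined by the condition that the
tetrad is covariantly constant, with `∇_a ∂_b = Γ_a^c_b ∂_c`. -/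
def christoffel (g : LocalGeometry) (y : Space) (a c b : Fin 4) : ℝ :=
  ∑ l, pauliComp l (g.spinDerivTetrad y a b) * (g.tetradMatrix y)⁻¹ l c

/-- The tetrad is covariantly constant: `∇_a θ_b = Γ_a^c_b θ_c`, in the Pauli frame. -/
theorem christoffel_spec (g : LocalGeometry) (y : Space) (h : (g.tetradMatrix y).det ≠ 0)
    (a b l : Fin 4) :
    ∑ c, g.christoffel y a c b * g.tetradMatrix y c l = pauliComp l (g.spinDerivTetrad y a b) := by
  have hu : IsUnit (g.tetradMatrix y).det := isUnit_iff_ne_zero.mpr h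
  have e : (fun l => pauliComp l (g.spinDerivTetrad y a b)) ᵥ* (g.tetradMatrix y)⁻¹ ᵥ*
      g.tetradMatrix y = fun l => pauliComp l (g.spinDerivTetrad y a b) := by
    rw [Matrix.vecMul_vecMul, Matrix.nonsing_inv_mul _ hu, Matrix.vecMul_one]
  exact congrFun e l

/-- The torsion `T^c_{ab} = Γ_a^c_b - Γ_b^c_a`, that is
`T(X, Y) = ∇_X Y - ∇_Y X - [X, Y]`. -/
def torsion (g : LocalGeometry) (y : Space) (c a b : Fin 4) : ℝ :=
  g.christoffel y a c b - g.christoffel y b c a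

/-- The torsion 1-form `T̆_a = T^b_{ab}`. -/
def torsionForm (g : LocalGeometry) (y : Space) (a : Fin 4) : ℝ := ∑ b, g.torsion y b a b

/-- `γ̌[T̆] = T̆_a γ̌^a`. -/
def gammaTorsion (g : LocalGeometry) {r : ℕ} (y : Space) : Model r →L[ℂ] Model r :=
  ∑ a, ((g.torsionForm y a : ℝ) : ℂ) • g.gammaUp (r := r) y a

/-- The covariant derivative `∇_a Ψ`. -/
def nabla (g : LocalGeometry) {r : ℕ} (ψ : Space → Model r) (y : Space) (a : Fin 4) : Model r :=
  partialDeriv a ψ y + act (g.conn y a) (ψ y)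

/-- The covariant derivative `∇_a Ψ̄` of a field with values in the dual bundle. -/
def nablaDual (g : LocalGeometry) {r : ℕ} (ψb : Space → ModelDual r) (y : Space) (a : Fin 4) :
    ModelDual r :=
  partialDeriv a ψb y - (ψb y).comp (act (g.conn y a))

/-- The generalised Dirac operator `γ̌^a ∇_a Ψ`. -/
def dslash (g : LocalGeometry) {r : ℕ} (ψ : Space → Model r) (y : Space) : Model r :=
  ∑ a, g.gammaUp y a (g.nabla ψ y a)

/-- The generalised Dirac operator on the dual bundle, `γ̌` acting by transposition. -/
def dslashDual (g : LocalGeometry) {r : ℕ} (ψb : Space → ModelDual r) (y : Space) : ModelDual r :=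
  ∑ a, (g.nablaDual ψb y a).comp (g.gammaUp y a)

/-- The Lagrangian density
`ℓ = |θ| ((i/2) (⟨Ψ̄, γ̌^a ∇_a Ψ⟩ - ⟨∇_a Ψ̄ γ̌^a, Ψ⟩) - m ⟨Ψ̄, Ψ⟩)` as a function of the
independent variables `w = Ψ`, `wb = Ψ̄`, `q = ∇Ψ`, `qb = ∇Ψ̄`. -/
def density (g : LocalGeometry) (m : ℝ) {r : ℕ} (y : Space) (w : Model r) (wb : ModelDual r)
    (q : Fin 4 → Model r) (qb : Fin 4 → ModelDual r) : ℂ :=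
  (g.vol y : ℂ) *
    (Complex.I / 2 *
        (wb (∑ a, g.gammaUp y a (q a)) - (∑ a, (qb a).comp (g.gammaUp y a)) w) -
      (m : ℂ) * wb w)

/-- The same density as a Lagrangian for the pair `(Ψ, Ψ̄)` and its coordinate derivatives. -/
def lagrangian (g : LocalGeometry) (m : ℝ) {r : ℕ} (y : Space) (w : Model r × ModelDual r)
    (p : Fin 4 → Model r × ModelDual r) : ℂ :=
  g.density m y w.1 w.2 (fun a => (p a).1 + act (g.conn y a) w.1)
    (fun a => (p a).2 - w.2.comp (act (g.conn y a)))

/-- `∂ℓ/∂Ψ`, at fixed `∇Ψ`, `∇Ψ̄`. -/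
def momentum₀ (g : LocalGeometry) (m : ℝ) {r : ℕ} (ψ : Space → Model r)
    (ψb : Space → ModelDual r) (y : Space) : Model r →L[ℂ] ℂ :=
  fderiv ℂ (fun w => g.density m y w (ψb y) (g.nabla ψ y) (g.nablaDual ψb y)) (ψ y)

/-- `∂ℓ/∂Ψ̄`, at fixed `∇Ψ`, `∇Ψ̄`. -/
def momentumDual₀ (g : LocalGeometry) (m : ℝ) {r : ℕ} (ψ : Space → Model r)
    (ψb : Space → ModelDual r) (y : Space) : ModelDual r →L[ℂ] ℂ :=
  fderiv ℂ (fun wb => g.density m y (ψ y) wb (g.nabla ψ y) (g.nablaDual ψb y)) (ψb y)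

/-- `∂ℓ/∂(∇_a Ψ)`. -/
def momentum₁ (g : LocalGeometry) (m : ℝ) {r : ℕ} (ψ : Space → Model r)
    (ψb : Space → ModelDual r) (y : Space) (a : Fin 4) : Model r →L[ℂ] ℂ :=
  (fderiv ℂ (fun q => g.density m y (ψ y) (ψb y) q (g.nablaDual ψb y)) (g.nabla ψ y)).comp
    (ContinuousLinearMap.single ℂ (fun _ : Fin 4 => Model r) a)

/-- `∂ℓ/∂(∇_a Ψ̄)`. -/
def momentumDual₁ (g : LocalGeometry) (m : ℝ) {r : ℕ} (ψ : Space → Model r)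
    (ψb : Space → ModelDual r) (y : Space) (a : Fin 4) : ModelDual r →L[ℂ] ℂ :=
  (fderiv ℂ (fun qb => g.density m y (ψ y) (ψb y) (g.nabla ψ y) qb) (g.nablaDual ψb y)).comp
    (ContinuousLinearMap.single ℂ (fun _ : Fin 4 => ModelDual r) a)

/-- The covariant differential of the dual-valued 3-form `Π^a ⊗ dx_a`: the coefficient of `d⁴x`
is `∂_a Π^a - Π^a ∘ Γ_a`. -/
def covDiff (g : LocalGeometry) {r : ℕ} (P : Space → Fin 4 → (Model r →L[ℂ] ℂ)) (y : Space)
    (η : Model r) : ℂ :=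
  ∑ a, (partialDeriv a (fun y' => P y' a η) y - P y a (act (g.conn y a) η))

/-- The covariant differential of a 3-form `Π̄^a ⊗ dx_a` with values in (the bidual of) `W^{r}`,
tested on elements of the dual. -/
def covDiffDual (g : LocalGeometry) {r : ℕ} (P : Space → Fin 4 → (ModelDual r →L[ℂ] ℂ))
    (y : Space) (ηb : ModelDual r) : ℂ :=
  ∑ a, (partialDeriv a (fun y' => P y' a ηb) y + P y a (ηb.comp (act (g.conn y a))))

/-- The canonical energy tensor
`𝒰^a_b = ℓ δ^a_b - ⟨∂ℓ/∂(∇_a Ψ), ∇_b Ψ⟩ - ⟨∂ℓ/∂(∇_a Ψ̄), ∇_b Ψ̄⟩`. -/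
def energyTensor (g : LocalGeometry) (m : ℝ) {r : ℕ} (ψ : Space → Model r)
    (ψb : Space → ModelDual r) (y : Space) (a b : Fin 4) : ℂ :=
  (if a = b then g.density m y (ψ y) (ψb y) (g.nabla ψ y) (g.nablaDual ψb y) else 0) -
    g.momentum₁ m ψ ψb y a (g.nabla ψ y b) - g.momentumDual₁ m ψ ψb y a (g.nablaDual ψb y b)

end LocalGeometry

/-! ## Spinor bundles and fields on a manifold -/

/-- The matrices by which components of undotted and dotted indices change from the basis `b'`
to the basis `b`: `u^A = g^A_B u'^B` for `b'_B = g^A_B b_A`, and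
`λ_{A'} = conj((g⁻¹)^{B'}_{A'}) λ'_{B'}`. -/
def changeOfBasis {V : Type*} [AddCommGroup V] [Module ℂ V] (b b' : Module.Basis (Fin 2) ℂ V)
    (t : Bool) : Mat2 :=
  bif t then (b'.toMatrix b)ᴴ else b.toMatrix b'

/-- An element of the space `W^{r}` built from the two-dimensional complex space `V`: a tensor,
given by its components in every basis of `V`. -/
structure HigherSpinor (V : Type*) [AddCommGroup V] [Module ℂ V] (r : ℕ) where
  comp : Module.Basis (Fin 2) ℂ V → Model r
  comp_eq : ∀ b b', comp b = transform (changeOfBasis b b') (comp b')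

/-- An element of the dual of the space `W^{r}` built from `V`. -/
structure DualHigherSpinor (V : Type*) [AddCommGroup V] [Module ℂ V] (r : ℕ) where
  comp : Module.Basis (Fin 2) ℂ V → ModelDual r
  comp_eq : ∀ b b' w, comp b (transform (changeOfBasis b b') w) = comp b' w

section Bundles

variable {M : Type*} [TopologicalSpace M] [ChartedSpace Space M] [IsManifold 𝓘(ℝ, Space) ∞ M]
  (U : M → Type*) [∀ x, AddCommGroup (U x)] [∀ x, Module ℂ (U x)] [∀ x, Module ℝ (U x)]
  [∀ x, TopologicalSpace (U x)] [TopologicalSpace (TotalSpace (Fin 2 → ℂ) U)]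
  [FiberBundle (Fin 2 → ℂ) U]

/-- A coordinate chart of `M` together with a smooth frame of `U` over its domain. (The values of
the frame outside of the domain are irrelevant.) -/
structure SpinorChart where
  chart : OpenPartialHomeomorph M Space
  chart_mem : chart ∈ IsManifold.maximalAtlas 𝓘(ℝ, Space) ∞ M
  frame : ∀ x, Module.Basis (Fin 2) ℂ (U x)
  frame_smooth : ∀ A, ContMDiffOn 𝓘(ℝ, Space) (𝓘(ℝ, Space).prod 𝓘(ℝ, Fin 2 → ℂ)) ∞
    (fun x => TotalSpace.mk' (Fin 2 → ℂ) x (frame x A)) chart.source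

variable {U}

/-- The coordinate vector `∂_a` at the point with coordinates `y`. -/
def SpinorChart.coordVector (c : SpinorChart U) (y : Space) (a : Fin 4) :
    TangentSpace 𝓘(ℝ, Space) (c.chart.symm y) :=
  mfderiv 𝓘(ℝ, Space) 𝓘(ℝ, Space) c.chart.symm y
    (EuclideanSpace.single a (1 : ℝ) : Space)

/-- The decomposable bivector `u ∧ v`. -/
def wedge {V : Type*} [AddCommGroup V] [Module ℂ V] (u v : V) : ⋀[ℂ]^2 V :=
  exteriorPower.ιMulti ℂ 2 ![u, v]

variable (U) in
/-- A two-spinor structure: a smooth (positive) Hermitian structure on the fibres of `Λ²U`. -/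
structure SpinorStructure where
  form : ∀ x, (⋀[ℂ]^2 (U x)) →ₗ⋆[ℂ] (⋀[ℂ]^2 (U x)) →ₗ[ℂ] ℂ
  form_symm : ∀ x s t, form x s t = conj (form x t s)
  form_pos : ∀ x s, s ≠ 0 → 0 < (form x s s).re
  form_smooth : ∀ c : SpinorChart U, ContDiffOn ℝ ∞
    (fun y => let x := c.chart.symm y
      form x (wedge (c.frame x 0) (c.frame x 1)) (wedge (c.frame x 0) (c.frame x 1)))
    c.chart.target

/-- The frame is normalised: `z_1 ∧ z_2` (hence also `ε = z^1 ∧ z^2`) has unit length. -/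
def SpinorStructure.IsNormalised (S : SpinorStructure U) (c : SpinorChart U) : Prop :=
  ∀ x ∈ c.chart.source,
    S.form x (wedge (c.frame x 0) (c.frame x 1)) (wedge (c.frame x 0) (c.frame x 1)) = 1

variable (U) in
/-- A non-degenerate tetrad: a smooth field of injective (hence bijective) linear maps from the
tangent spaces to the spaces of Hermitian elements of `U ⊗ Ū`, the latter being regarded as the
Hermitian forms on the dual of `U`; in this form `u ⊗ v̄` is `(λ, μ) ↦ λ(u) conj(μ(v))`. -/
structure Tetrad where
  form : ∀ x, TangentSpace 𝓘(ℝ, Space) x →ₗ[ℝ]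
    (Module.Dual ℂ (U x) →ₗ[ℂ] Module.Dual ℂ (U x) →ₗ⋆[ℂ] ℂ)
  hermitian : ∀ x X s t, form x X s t = conj (form x X t s)
  injective : ∀ x, Function.Injective (form x)
  smooth : ∀ (c : SpinorChart U) (a : Fin 4) (A A' : Fin 2), ContDiffOn ℝ ∞
    (fun y => form (c.chart.symm y) (c.coordVector y a)
      ((c.frame (c.chart.symm y)).coord A) ((c.frame (c.chart.symm y)).coord A')) c.chart.target

/-- A two-spinor connection: a complex linear connection of `U` whose induced connection on `Λ²U`
preserves the Hermitian structure. -/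
structure SpinorConnection [∀ x, IsTopologicalAddGroup (U x)] [∀ x, ContinuousSMul ℝ (U x)]
    (S : SpinorStructure U) where
  cov : CovariantDerivative 𝓘(ℝ, Space) (Fin 2 → ℂ) U
  complex_linear : ∀ (s : ∀ x, U x) (x : M),
    MDifferentiableAt 𝓘(ℝ, Space) (𝓘(ℝ, Space).prod 𝓘(ℝ, Fin 2 → ℂ))
      (fun x => TotalSpace.mk' (Fin 2 → ℂ) x (s x)) x →
    ∀ X, cov (fun x => Complex.I • s x) x X = Complex.I • cov s x X
  preserves : ∀ (s : Fin 4 → ∀ x, U x) (x : M),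
    (∀ i, MDifferentiableAt 𝓘(ℝ, Space) (𝓘(ℝ, Space).prod 𝓘(ℝ, Fin 2 → ℂ))
      (fun x => TotalSpace.mk' (Fin 2 → ℂ) x (s i x)) x) →
    ∀ X : TangentSpace 𝓘(ℝ, Space) x,
      mfderiv 𝓘(ℝ, Space) 𝓘(ℝ, ℂ)
          (fun x => S.form x (wedge (s 0 x) (s 1 x)) (wedge (s 2 x) (s 3 x))) x X =
        S.form x (wedge (cov (s 0) x X) (s 1 x) + wedge (s 0 x) (cov (s 1) x X))
            (wedge (s 2 x) (s 3 x)) +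
          S.form x (wedge (s 0 x) (s 1 x))
            (wedge (cov (s 2) x X) (s 3 x) + wedge (s 2 x) (cov (s 3) x X))

/-- The components of a `W^{r}`-valued field in a chart and frame. -/
def SpinorChart.field (c : SpinorChart U) {r : ℕ} (Ψ : ∀ x, HigherSpinor (U x) r) (y : Space) :
    Model r :=
  (Ψ (c.chart.symm y)).comp (c.frame (c.chart.symm y))

/-- The components of a field with values in the dual of `W^{r}`. -/
def SpinorChart.dualField (c : SpinorChart U) {r : ℕ} (Ψb : ∀ x, DualHigherSpinor (U x) r)
    (y : Space) : ModelDual r :=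
  (Ψb (c.chart.symm y)).comp (c.frame (c.chart.symm y))

/-- The components of the tetrad and of the spinor connection in a chart and frame. -/
def SpinorChart.geometry [∀ x, IsTopologicalAddGroup (U x)] [∀ x, ContinuousSMul ℝ (U x)]
    {S : SpinorStructure U} (c : SpinorChart U) (th : Tetrad U) (nab : SpinorConnection S) :
    LocalGeometry where
  tetrad y a := Matrix.of fun A A' => th.form (c.chart.symm y) (c.coordVector y a)
    ((c.frame (c.chart.symm y)).coord A) ((c.frame (c.chart.symm y)).coord A')
  conn y a := Matrix.of fun A B => (c.frame (c.chart.symm y)).coord A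
    (nab.cov (fun x => c.frame x B) (c.chart.symm y) (c.coordVector y a))

end Bundles

end HigherSpin

end

namespace HigherSpin

/-! ## Equivariance of the generalised Dirac map -/

/-! In a chart and frame the density is affine in each of `Ψ`, `Ψ̄`, `∇Ψ`, `∇Ψ̄` separately. The
momenta and the energy tensor are therefore read off from its linear parts, and the form of the
Euler-Lagrange expressions with `d_Γ` is a regrouping of the connection terms.

The content lies in the field equations. The total derivative in the Euler-Lagrange expression falls
half on the field, which completes the kinetic term from `i/2` to `i`, and half on `|θ| γ̌^a`.
Together with the connection terms the latter is the covariant divergence of `|θ| γ̌^a`, and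
`sum_derivDensGamma` identifies it with `|θ| γ̌[T̆]`. Two facts give this identity.

Algebra: `act_gammaCheck_sub` says that the commutator of the action of `K` with `γ̌[Y]` is `γ̌[KY +
YK†]` as soon as `Re tr K = 0`, the infinitesimal condition for preserving the norm of `ε`. The
connection matrices satisfy it by `SpinorChart.trace_conn`, because the frame is normalised.

Analysis: in the Pauli frame `γ̌^a` is a combination of the constant maps `γ̌[τ_l]` with scalar
coefficients (`gammaUp_eq`), so only the functions `|θ| θ^a_l` are differentiated. Jacobi's formula
and the derivative of an inverse matrix produce the antisymmetrised derivatives of the tetrad. The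
connection acts by elements of the Lorentz Lie algebra, and their antisymmetry turns the rest into
the torsion form (`sum_partialDeriv_densTetrad`).

The factor `|θ|` can be cancelled because the tetrad is injective. -/

theorem slotType_of_ne_lastSlot {r : ℕ} (k : Sector r) {i : Fin r} (h : i ≠ lastSlot k) :
    slotType (source k) i = slotType k i := by
  obtain ⟨b, n, hn⟩ := k
  have hi := i.2
  have h' : (i : ℕ) ≠ r - 1 - ((source (b, (⟨n, hn⟩ : Fin r))).2 : ℕ) := fun e => h (Fin.ext e)
  unfold source at h'
  unfold slotType source
  by_cases h0 : n = 0
  · subst h0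
    simp only [if_true] at h' ⊢
    -- Here the cyclic sequence passes from one family to the other: the first block of the source
    -- has length one, so `lastSlot` is the slot `0`, and the two negations of the family label
    -- cancel in all other slots.
    rw [if_neg (by omega), if_pos (by omega)]
    simp
  · simp only [h0, if_false] at h' ⊢
    by_cases h1 : (i : ℕ) < r - n
    · rw [if_pos (by omega), if_pos h1]
    · rw [if_neg (by omega), if_neg h1]

theorem slotType_source_lastSlot {r : ℕ} (k : Sector r) :
    slotType (source k) (lastSlot k) = (source k).1 := by
  have := k.2.2
  have := (source k).2.2
  unfold slotType lastSlot
  rw [if_pos (by simp only; omega)]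

theorem slotType_lastSlot {r : ℕ} (k : Sector r) :
    slotType k (lastSlot k) = !(source k).1 := by
  obtain ⟨b, n, hn⟩ := k
  unfold slotType lastSlot source
  by_cases h0 : n = 0
  · subst h0
    simp only [if_true]
    rw [if_pos (by omega)]
    simp
  · simp only [h0, if_false]
    rw [if_neg (by omega)]

/-- The matrix by which the endomorphism `K` of `U` acts on an index of type `t`. -/
noncomputable def slotMatrix (K : Mat2) (t : Bool) : Mat2 := bif t then -Kᴴ else K

/-- The replacement of the index in the slot `j` by means of the matrix `D`. -/
noncomputable def contract {r : ℕ} (D : Mat2) (j : Fin r) (f : (Fin r → Fin 2) → ℂ) :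
    (Fin r → Fin 2) → ℂ :=
  fun β => ∑ c, D (β j) c * f (Function.update β j c)

theorem contract_comm {r : ℕ} (D D' : Mat2) {i j : Fin r} (h : i ≠ j)
    (f : (Fin r → Fin 2) → ℂ) :
    contract D i (contract D' j f) = contract D' j (contract D i f) := by
  funext β
  simp only [contract, Finset.mul_sum]
  rw [Finset.sum_comm]
  refine Finset.sum_congr rfl fun c _ => Finset.sum_congr rfl fun d _ => ?_
  rw [Function.update_of_ne h.symm, Function.update_of_ne h, Function.update_comm h]
  ring

theorem contract_contract {r : ℕ} (D D' : Mat2) (j : Fin r) (f : (Fin r → Fin 2) → ℂ) :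
    contract D j (contract D' j f) = contract (D * D') j f := by
  funext β
  simp only [contract, Finset.mul_sum, Matrix.mul_apply, Finset.sum_mul]
  rw [Finset.sum_comm]
  refine Finset.sum_congr rfl fun c _ => Finset.sum_congr rfl fun d _ => ?_
  simp [mul_assoc]

theorem contract_sub {r : ℕ} (D D' : Mat2) (j : Fin r) (f : (Fin r → Fin 2) → ℂ) :
    contract (D - D') j f = contract D j f - contract D' j f := by
  funext β
  simp [contract, sub_mul]

theorem contract_sum {r : ℕ} {ι : Type*} (s : Finset ι) (D : Mat2) (j : Fin r)
    (f : ι → (Fin r → Fin 2) → ℂ) :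
    contract D j (∑ i ∈ s, f i) = ∑ i ∈ s, contract D j (f i) := by
  funext β
  simp only [contract, Finset.sum_apply, Finset.mul_sum]
  exact Finset.sum_comm

theorem actComp_eq_sum_contract {r : ℕ} (K : Mat2) (Φ : Comp r) (k : Sector r) :
    actComp K Φ k = ∑ i, contract (slotMatrix K (slotType k i)) i (Φ k) := by
  funext α
  simp [actComp, contract, slotMatrix]

theorem gammaComp_eq_symmetrise_contract {r : ℕ} (Y : Mat2) (Φ : Comp r) (k : Sector r) :
    gammaComp Y Φ k =
      symmetrise k (contract (diracMatrix (source k).1 Y) (lastSlot k) (Φ (source k))) :=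
  rfl

theorem symmetrise_sub {r : ℕ} (k : Sector r) (f f' : (Fin r → Fin 2) → ℂ) :
    symmetrise k (f - f') = symmetrise k f - symmetrise k f' := by
  funext α
  simp [symmetrise, mul_sub]

/-- A block permutation only exchanges slots of equal type, so it merely reorders the sum over
slots. Symmetry of `f` itself is not needed, which matters because the contracted array is not yet
symmetric. -/
theorem sum_contract_symmetrise {r : ℕ} (K : Mat2) (k : Sector r) (f : (Fin r → Fin 2) → ℂ) :
    ∑ i, contract (slotMatrix K (slotType k i)) i (symmetrise k f) =
      symmetrise k (∑ i, contract (slotMatrix K (slotType k i)) i f) := by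
  funext α
  simp only [Finset.sum_apply, contract, symmetrise]
  have key : ∀ s : blockPerms k,
      (∑ i, ∑ c, slotMatrix K (slotType k i) ((α ∘ (s : Equiv.Perm (Fin r))) i) c *
        f (Function.update (α ∘ (s : Equiv.Perm (Fin r))) i c)) =
      ∑ i, ∑ c, slotMatrix K (slotType k i) (α i) c *
        f (Function.update α i c ∘ (s : Equiv.Perm (Fin r))) := by
    rintro ⟨s, hs⟩
    refine Fintype.sum_equiv s _ _ fun i => Finset.sum_congr rfl fun c _ => ?_
    rw [update_comp_perm, hs i]
    rfl
  simp only [key, Finset.mul_sum]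
  rw [Finset.sum_comm (s := (Finset.univ : Finset (blockPerms k)))]
  refine Finset.sum_congr rfl fun i _ => ?_
  rw [Finset.sum_comm]
  refine Finset.sum_congr rfl fun c _ => Finset.sum_congr rfl fun s _ => ?_
  ring

/-- For a dotted source index this is a plain identity. For an undotted one the indices of `Y` are
lowered with `ε`, which `K` scales by its trace; the dotted and undotted factors together leave `tr
K + conj (tr K)`, and this vanishes. -/
theorem slotMatrix_mul_diracMatrix {K : Mat2} (hK : K.trace + conj K.trace = 0) (t : Bool)
    (Y : Mat2) :
    slotMatrix K (!t) * diracMatrix t Y - diracMatrix t Y * slotMatrix K t =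
      diracMatrix t (K * Y + Y * Kᴴ) := by
  cases t
  · ext i j
    fin_cases i <;> fin_cases j <;>
      simp [slotMatrix, diracMatrix, lower, eps, Matrix.mul_apply, Fin.sum_univ_two,
        Matrix.trace_fin_two] at hK ⊢
    · linear_combination -(Real.sqrt 2 * Y 1 1 : ℂ) * hK
    · linear_combination (Real.sqrt 2 * Y 0 1 : ℂ) * hK
    · linear_combination (Real.sqrt 2 * Y 1 0 : ℂ) * hK
    · linear_combination -(Real.sqrt 2 * Y 0 0 : ℂ) * hK
  · simp [slotMatrix, diracMatrix]

/-- The Leibniz action passes through the symmetrisation and becomes a sum over slots. Away from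
`lastSlot` source and target have the same type, and operations on different slots commute, so these
terms cancel. The remaining slot is `slotMatrix_mul_diracMatrix`. -/
theorem act_gammaCheck_sub {r : ℕ} {K : Mat2} (hK : K.trace + conj K.trace = 0) (Y : Mat2)
    (w : Model r) :
    act K (gammaCheck Y w) - gammaCheck Y (act K w) = gammaCheck (K * Y + Y * Kᴴ) w := by
  apply Subtype.ext
  funext k
  change actComp K (gammaComp Y w) k - gammaComp Y (actComp K w) k = gammaComp _ w k
  rw [actComp_eq_sum_contract]
  simp only [gammaComp_eq_symmetrise_contract, actComp_eq_sum_contract]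
  rw [sum_contract_symmetrise, ← symmetrise_sub, contract_sum, ← Finset.sum_sub_distrib,
    Finset.sum_eq_single (lastSlot k)]
  · rw [slotType_lastSlot, slotType_source_lastSlot, contract_contract, contract_contract,
      ← contract_sub, slotMatrix_mul_diracMatrix hK]
  · intro i _ hi
    rw [slotType_of_ne_lastSlot k hi, contract_comm _ _ hi, sub_self]
  · simp

theorem diracMatrix_add (t : Bool) (Y Y' : Mat2) :
    diracMatrix t (Y + Y') = diracMatrix t Y + diracMatrix t Y' := by
  cases t <;> simp [diracMatrix, lower, mul_add, add_mul]

theorem diracMatrix_smul (t : Bool) (z : ℂ) (Y : Mat2) :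
    diracMatrix t (z • Y) = z • diracMatrix t Y := by
  cases t <;> simp [diracMatrix, lower, smul_comm z]

/-- The generalised Dirac map is linear in the vector. -/
noncomputable def gammaLinear (r : ℕ) : Mat2 →ₗ[ℂ] Model r →L[ℂ] Model r where
  toFun := gammaCheck
  map_add' Y Y' := by
    ext w k α
    change gammaComp (Y + Y') w k α = gammaComp Y w k α + gammaComp Y' w k α
    simp only [gammaComp, symmetrise, diracMatrix_add, Matrix.add_apply, add_mul,
      Finset.sum_add_distrib, mul_add]
  map_smul' z Y := by
    ext w k α
    change gammaComp (z • Y) w k α = z * gammaComp Y w k α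
    simp only [gammaComp, symmetrise, diracMatrix_smul, Matrix.smul_apply, smul_eq_mul,
      Finset.mul_sum, mul_assoc, mul_left_comm z]

/-! ## The Pauli frame -/

/-- The orthonormal Pauli frame `τ_l = σ_l / √2`. -/
noncomputable def pauliFrame (l : Fin 4) : Mat2 := ((Real.sqrt 2 : ℂ)⁻¹) • pauli l

/-- The diagonal of the Minkowski metric. -/
def minkowski : Fin 4 → ℝ := ![1, -1, -1, -1]

theorem sqrt_two_inv_mul_self : ((Real.sqrt 2 : ℂ)⁻¹) * ((Real.sqrt 2 : ℂ)⁻¹) = 1 / 2 := by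
  rw [← mul_inv, ← Complex.ofReal_mul, Real.mul_self_sqrt (by norm_num)]
  norm_num

theorem minkowski_mul_self (l : Fin 4) : minkowski l * minkowski l = 1 := by
  fin_cases l <;> simp [minkowski]

theorem sum_pauliComp_smul_pauliFrame {Y : Mat2} (hY : Y.IsHermitian) :
    ∑ l, (pauliComp l Y : ℂ) • pauliFrame l = Y := by
  have h00 := hY.apply 0 0
  have h11 := hY.apply 1 1
  have h01 := hY.apply 0 1
  simp only [Complex.star_def] at h00 h11 h01
  have h : ∀ l, (pauliComp l Y : ℂ) • pauliFrame l =
      (1 / 2 * (((pauli l * Y).trace).re : ℂ)) • pauli l := by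
    intro l
    rw [pauliComp, pauliFrame, smul_smul, Complex.ofReal_div, div_eq_mul_inv, mul_assoc,
      sqrt_two_inv_mul_self]
    congr 1
    ring
  simp only [h]
  rw [Complex.ext_iff] at h00 h11 h01
  ext i j
  fin_cases i <;> fin_cases j <;>
    simp [Fin.sum_univ_four, pauli, Matrix.trace_fin_two, Matrix.mul_apply, Fin.sum_univ_two,
      Complex.ext_iff] at h00 h11 h01 ⊢ <;> constructor <;> linarith

theorem pauliComp_add (l : Fin 4) (Y Y' : Mat2) :
    pauliComp l (Y + Y') = pauliComp l Y + pauliComp l Y' := by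
  simp [pauliComp, mul_add, add_div]

theorem pauliComp_smul (l : Fin 4) (x : ℝ) (Y : Mat2) :
    pauliComp l ((x : ℂ) • Y) = x * pauliComp l Y := by
  simp [pauliComp, mul_div_assoc]

/-- `pauliComp l` as a linear map. -/
noncomputable def pauliCompL (l : Fin 4) : Mat2 →ₗ[ℝ] ℝ where
  toFun := pauliComp l
  map_add' := pauliComp_add l
  map_smul' x Y := pauliComp_smul l x Y

theorem isHermitian_pauliFrame (l : Fin 4) : (pauliFrame l).IsHermitian := by
  ext i j
  fin_cases l <;> fin_cases i <;> fin_cases j <;> simp [pauliFrame, pauli]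

theorem lorentz_pauliFrame (l : Fin 4) (Y : Mat2) :
    lorentz (pauliFrame l) Y = minkowski l * pauliComp l Y := by
  have h : (Real.sqrt 2)⁻¹ = Real.sqrt 2 * (1 / 2) := by
    rw [inv_eq_iff_eq_inv, mul_inv, ← div_eq_mul_inv, eq_div_iff (by norm_num)]
    field_simp
    norm_num
  fin_cases l <;>
    simp [lorentz, lower, eps, pauliFrame, pauli, minkowski, pauliComp, Matrix.mul_apply,
      Fin.sum_univ_two, Matrix.trace_fin_two, Matrix.vecMul, dotProduct, div_eq_mul_inv, h] <;> ring

theorem lorentz_comm (X Y : Mat2) : lorentz X Y = lorentz Y X := by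
  unfold lorentz
  congr 1
  simp [lower, eps, Matrix.mul_apply, Fin.sum_univ_two]
  ring

/-- `lorentz` as a bilinear form. -/
noncomputable def lorentzForm : Mat2 →ₗ[ℝ] Mat2 →ₗ[ℝ] ℝ :=
  LinearMap.mk₂ ℝ lorentz
    (fun X X' Y => by
      simp [lorentz, lower, mul_add, add_mul, Finset.sum_add_distrib])
    (fun x X Y => by
      simp [lorentz, lower, mul_assoc]
      ring)
    (fun X Y Y' => by
      simp [lorentz, mul_add, Finset.sum_add_distrib])
    (fun x X Y => by
      simp [lorentz, mul_left_comm]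
      ring)

theorem lorentz_eq_sum {X : Mat2} (hX : X.IsHermitian) (Y : Mat2) :
    lorentz X Y = ∑ l, pauliComp l X * minkowski l * pauliComp l Y := by
  conv_lhs => rw [← sum_pauliComp_smul_pauliFrame hX]
  change lorentzForm _ Y = _
  rw [map_sum, LinearMap.sum_apply]
  refine Finset.sum_congr rfl fun l _ => ?_
  rw [show (pauliComp l X : ℂ) • pauliFrame l = pauliComp l X • pauliFrame l from rfl,
    map_smul, LinearMap.smul_apply, smul_eq_mul, mul_assoc, ← lorentz_pauliFrame]
  rfl

/-- The metric is the polarised determinant (times two on the diagonal), and `Y ↦ KY + YK†` scales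
it infinitesimally by `tr K + conj (tr K)`. -/
theorem lorentz_invariant {K : Mat2} (hK : K.trace + conj K.trace = 0) (X Y : Mat2) :
    lorentz (K * X + X * Kᴴ) Y + lorentz X (K * Y + Y * Kᴴ) = 0 := by
  unfold lorentz
  rw [← Complex.add_re, ← Complex.zero_re]
  congr 1
  simp [lower, eps, Matrix.mul_apply, Fin.sum_univ_two, Matrix.trace_fin_two] at hK ⊢
  linear_combination (X 0 0 * Y 1 1 + X 1 1 * Y 0 0 - X 0 1 * Y 1 0 - X 1 0 * Y 0 1) * hK

/-- The matrix in the Pauli frame of the action of `K` on Hermitian elements. -/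
noncomputable def frameAction (K : Mat2) (l n : Fin 4) : ℝ :=
  pauliComp l (K * pauliFrame n + pauliFrame n * Kᴴ)

theorem isHermitian_action (K : Mat2) {Y : Mat2} (hY : Y.IsHermitian) :
    (K * Y + Y * Kᴴ).IsHermitian := by
  unfold Matrix.IsHermitian
  rw [Matrix.conjTranspose_add, Matrix.conjTranspose_mul, Matrix.conjTranspose_mul,
    Matrix.conjTranspose_conjTranspose, hY.eq, add_comm]

/-- Invariance of the metric, read in an orthonormal frame: the action lies in the Lorentz Lie
algebra. -/
theorem minkowski_mul_frameAction {K : Mat2} (hK : K.trace + conj K.trace = 0) (l n : Fin 4) :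
    minkowski l * frameAction K l n = -(minkowski n * frameAction K n l) := by
  have h := lorentz_invariant hK (pauliFrame l) (pauliFrame n)
  rw [lorentz_comm (K * _ + _), lorentz_pauliFrame, lorentz_pauliFrame] at h
  unfold frameAction
  linarith

theorem pauliComp_action (K : Mat2) {Y : Mat2} (hY : Y.IsHermitian) (l : Fin 4) :
    pauliComp l (K * Y + Y * Kᴴ) = ∑ n, frameAction K l n * pauliComp n Y := by
  conv_lhs => rw [← sum_pauliComp_smul_pauliFrame hY]
  rw [Finset.mul_sum, Finset.sum_mul, ← Finset.sum_add_distrib]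
  change pauliCompL l _ = _
  rw [map_sum]
  refine Finset.sum_congr rfl fun n _ => ?_
  rw [Matrix.mul_smul, Matrix.smul_mul, ← smul_add]
  exact (pauliComp_smul _ _ _).trans (mul_comm _ _)

theorem gammaCheck_eq_sum {r : ℕ} {Y : Mat2} (hY : Y.IsHermitian) :
    gammaCheck (r := r) Y = ∑ l, (pauliComp l Y : ℂ) • gammaCheck (r := r) (pauliFrame l) := by
  change gammaLinear r Y = ∑ l, (pauliComp l Y : ℂ) • gammaLinear r (pauliFrame l)
  conv_lhs => rw [← sum_pauliComp_smul_pauliFrame hY, map_sum]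
  exact Finset.sum_congr rfl fun l _ => (gammaLinear r).map_smul _ _

theorem act_gammaCheck_pauliFrame_sub {r : ℕ} {K : Mat2} (hK : K.trace + conj K.trace = 0)
    (l : Fin 4) (w : Model r) :
    act K (gammaCheck (pauliFrame l) w) - gammaCheck (pauliFrame l) (act K w) =
      ∑ n, (frameAction K n l : ℂ) • gammaCheck (pauliFrame n) w := by
  rw [act_gammaCheck_sub hK, gammaCheck_eq_sum (isHermitian_action K (isHermitian_pauliFrame l)),
    sum_apply]
  rfl

/-! ## Derivatives of determinants and inverse matrices -/

section MatrixCalculus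

variable {E n : Type*} [NormedAddCommGroup E] [NormedSpace ℝ E] [Fintype n] [DecidableEq n]

/-- Jacobi's formula. The determinant is multilinear in the rows, so its derivative is a sum of
determinants with one row replaced, and Cramer's rule writes these by the adjugate. -/
theorem hasFDerivAt_matrix_det {θ : E → Matrix n n ℝ} {θ' : n → n → E →L[ℝ] ℝ} {y : E}
    (h : ∀ b l, HasFDerivAt (fun y => θ y b l) (θ' b l) y) :
    HasFDerivAt (fun y => (θ y).det) (∑ b, ∑ l, (θ y).adjugate l b • θ' b l) y := by
  let d : ContinuousMultilinearMap ℝ (fun _ : n => n → ℝ) ℝ :=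
    { (Matrix.detRowAlternating (n := n) (R := ℝ)).toMultilinearMap with
      cont := Continuous.matrix_det (A := fun M : n → n → ℝ => Matrix.of M) continuous_id }
  have hθ : HasFDerivAt (fun y => (fun b l => θ y b l : n → n → ℝ))
      (ContinuousLinearMap.pi fun b => ContinuousLinearMap.pi fun l => θ' b l) y :=
    hasFDerivAt_pi.2 fun b => hasFDerivAt_pi.2 fun l => h b l
  have hd := (d.hasFDerivAt (fun b l => θ y b l)).comp y hθ
  refine hd.congr_fderiv ?_
  ext v
  simp only [ContinuousLinearMap.comp_apply, ContinuousMultilinearMap.linearDeriv_apply,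
    sum_apply, smul_apply, smul_eq_mul]
  refine Finset.sum_congr rfl fun b _ => ?_
  change ((θ y).updateRow b fun l => θ' b l v).det = _
  rw [← Matrix.cramer_transpose_apply, Matrix.cramer_eq_adjugate_mulVec,
    ← Matrix.adjugate_transpose]
  rfl

theorem differentiableAt_matrix_inv {θ : E → Matrix n n ℝ} {y : E}
    (h : ∀ b l, DifferentiableAt ℝ (fun y => θ y b l) y) (hy : (θ y).det ≠ 0) (l a : n) :
    DifferentiableAt ℝ (fun y => (θ y)⁻¹ l a) y := by
  simp only [Matrix.inv_def, Matrix.smul_apply, smul_eq_mul, Ring.inverse_eq_inv',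
    Matrix.adjugate_apply]
  refine ((hasFDerivAt_matrix_det fun b l => (h b l).hasFDerivAt).differentiableAt.inv hy).mul
    -- A cofactor is the determinant of `θ` with one row replaced by a constant one, so the
    -- determinant lemma applies again.
    (hasFDerivAt_matrix_det fun b m => DifferentiableAt.hasFDerivAt ?_).differentiableAt
  by_cases hb : b = a
  · subst hb
    simp
  · simpa [Matrix.updateRow_ne hb] using h b m

theorem fderiv_matrix_inv_apply {θ : E → Matrix n n ℝ} {y : E}
    (h : ∀ b l, DifferentiableAt ℝ (fun y => θ y b l) y) (hy : (θ y).det ≠ 0) (l a : n) (v : E) :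
    fderiv ℝ (fun y => (θ y)⁻¹ l a) y v =
      -∑ b, ∑ m, (θ y)⁻¹ l b * fderiv ℝ (fun y => θ y b m) y v * (θ y)⁻¹ m a := by
  have hev : ∀ᶠ y' in nhds y, (θ y').det ≠ 0 :=
    (hasFDerivAt_matrix_det fun b l => (h b l).hasFDerivAt).continuousAt.eventually_ne hy
  let e' : Matrix n n ℝ := Matrix.of fun l a => fderiv ℝ (fun y => (θ y)⁻¹ l a) y v
  let θ' : Matrix n n ℝ := Matrix.of fun b m => fderiv ℝ (fun y => θ y b m) y v
  have key : e' * θ y + (θ y)⁻¹ * θ' = 0 := by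
    ext i j
    -- The relation `θ⁻¹ θ = 1` holds on a neighbourhood, so it can be differentiated and solved for
    -- the derivative of the inverse.
    have h0 : (fun y' => ∑ k, (θ y')⁻¹ i k * θ y' k j) =ᶠ[nhds y]
        fun _ => (1 : Matrix n n ℝ) i j := by
      filter_upwards [hev] with y' hy'
      rw [← Matrix.mul_apply, Matrix.nonsing_inv_mul _ (isUnit_iff_ne_zero.2 hy')]
    have h1 := h0.fderiv_eq (𝕜 := ℝ)
    rw [fderiv_fun_sum fun k _ => (differentiableAt_matrix_inv h hy i k).fun_mul (h k j)] at h1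
    have h2 := congrArg (fun L : E →L[ℝ] ℝ => L v) h1
    simp only [sum_apply, fderiv_fun_const, Pi.zero_apply, zero_apply,
      fderiv_fun_mul (differentiableAt_matrix_inv h hy i _) (h _ j), add_apply, smul_apply,
      smul_eq_mul] at h2
    simp only [Matrix.add_apply, Matrix.mul_apply, ← Finset.sum_add_distrib, Matrix.zero_apply,
      e', θ', Matrix.of_apply]
    rw [← h2]
    exact Finset.sum_congr rfl fun k _ => by ring
  have h3 : e' = -((θ y)⁻¹ * θ' * (θ y)⁻¹) := by
    have h4 := congrArg (· * (θ y)⁻¹) key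
    simp only [add_mul, zero_mul] at h4
    rw [Matrix.mul_assoc e', Matrix.mul_nonsing_inv _ (isUnit_iff_ne_zero.2 hy), mul_one] at h4
    exact eq_neg_of_add_eq_zero_left h4
  have h5 := congrFun (congrFun h3 l) a
  change e' l a = _
  rw [h5, Matrix.neg_apply, Matrix.mul_apply, Finset.sum_congr rfl fun k _ => by
    rw [Matrix.mul_apply, Finset.sum_mul], Finset.sum_comm]
  rfl

theorem hasFDerivAt_abs_matrix_det {θ : E → Matrix n n ℝ} {y : E}
    (h : ∀ b l, DifferentiableAt ℝ (fun y => θ y b l) y) (hy : (θ y).det ≠ 0) :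
    HasFDerivAt (fun y => |(θ y).det|)
      (|(θ y).det| • ∑ b, ∑ l, (θ y)⁻¹ l b • fderiv ℝ (fun y => θ y b l) y) y := by
  have h1 := (hasDerivAt_abs hy).comp_hasFDerivAt y
    (hasFDerivAt_matrix_det fun b l => (h b l).hasFDerivAt)
  refine h1.congr_fderiv ?_
  simp only [Finset.smul_sum, smul_smul]
  refine Finset.sum_congr rfl fun b _ => Finset.sum_congr rfl fun l _ => ?_
  congr 1
  rw [Matrix.inv_def, Matrix.smul_apply, smul_eq_mul, Ring.inverse_eq_inv']
  rw [← mul_assoc]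
  congr 1
  rw [eq_mul_inv_iff_mul_eq₀ hy, sign_mul_self]

end MatrixCalculus

/-! ## Coordinate derivatives -/

section PartialDeriv

variable {F : Type*} [NormedAddCommGroup F] [NormedSpace ℝ F]

theorem partialDeriv_const (a : Fin 4) (x : F) (y : Space) :
    partialDeriv a (fun _ => x) y = 0 := by
  simp [partialDeriv]

theorem partialDeriv_congr {f f' : Space → F} {y : Space} (h : f =ᶠ[nhds y] f') (a : Fin 4) :
    partialDeriv a f y = partialDeriv a f' y := by
  rw [partialDeriv, h.fderiv_eq, partialDeriv]

theorem partialDeriv_prodMk {F' : Type*} [NormedAddCommGroup F'] [NormedSpace ℝ F']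
    {f : Space → F} {f' : Space → F'} {y : Space} (h : DifferentiableAt ℝ f y)
    (h' : DifferentiableAt ℝ f' y) (a : Fin 4) :
    partialDeriv a (fun y => (f y, f' y)) y = (partialDeriv a f y, partialDeriv a f' y) := by
  simp [partialDeriv, h.fderiv_prodMk h']

theorem partialDeriv_const_mul (z : ℂ) (f : Space → ℂ) (a : Fin 4) (y : Space) :
    partialDeriv a (fun y => z * f y) y = z * partialDeriv a f y := by
  unfold partialDeriv
  rw [show (fun y => z * f y) = z • f from rfl, fderiv_const_smul_field]
  rfl

end PartialDeriv

namespace LocalGeometry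

variable {g : LocalGeometry} {y : Space}

/-! ## The tetrad and its derivatives -/

theorem metric_eq (hH : ∀ y a, (g.tetrad y a).IsHermitian) (y : Space) :
    g.metric y = g.tetradMatrix y * Matrix.diagonal minkowski * (g.tetradMatrix y)ᵀ := by
  ext a b
  rw [Matrix.mul_apply]
  simp only [Matrix.mul_diagonal, Matrix.transpose_apply]
  exact lorentz_eq_sum (hH y a) _

theorem metric_inv_mul_tetradMatrix (hH : ∀ y a, (g.tetrad y a).IsHermitian)
    (hdet : (g.tetradMatrix y).det ≠ 0) :
    (g.metric y)⁻¹ * g.tetradMatrix y = ((g.tetradMatrix y)⁻¹)ᵀ * Matrix.diagonal minkowski := by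
  have hd : (Matrix.diagonal minkowski)⁻¹ = Matrix.diagonal minkowski := by
    refine Matrix.inv_eq_left_inv ?_
    rw [Matrix.diagonal_mul_diagonal, ← Matrix.diagonal_one]
    simp only [minkowski_mul_self]
  rw [metric_eq hH, Matrix.mul_inv_rev, Matrix.mul_inv_rev, hd, Matrix.mul_assoc,
    Matrix.mul_assoc, Matrix.nonsing_inv_mul _ (isUnit_iff_ne_zero.2 hdet), mul_one,
    Matrix.transpose_nonsing_inv]

/-- From `g = θ η θᵀ` and `η² = 1` one gets `g⁻¹ θ = θ⁻ᵀ η`. All dependence on the point is thereby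
moved into scalars, and the inverse metric never has to be differentiated. -/
theorem gammaUp_eq (hH : ∀ y a, (g.tetrad y a).IsHermitian)
    (hdet : (g.tetradMatrix y).det ≠ 0) {r : ℕ} (a : Fin 4) (w : Model r) :
    g.gammaUp y a w =
      ∑ l, (((g.tetradMatrix y)⁻¹ l a * minkowski l : ℝ) : ℂ) • gammaCheck (pauliFrame l) w := by
  have h : ∀ l, (g.tetradMatrix y)⁻¹ l a * minkowski l =
      ∑ b, (g.metric y)⁻¹ a b * pauliComp l (g.tetrad y b) := fun l => by
    have := congrFun (congrFun (metric_inv_mul_tetradMatrix hH hdet) a) l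
    rw [Matrix.mul_diagonal, Matrix.transpose_apply] at this
    rw [← this]
    rfl
  rw [gammaUp, sum_apply]
  simp only [h, smul_apply, Complex.ofReal_sum, Finset.sum_smul]
  rw [Finset.sum_comm]
  refine Finset.sum_congr rfl fun b _ => ?_
  rw [gammaCheck_eq_sum (hH y b), sum_apply, Finset.smul_sum]
  refine Finset.sum_congr rfl fun l _ => ?_
  rw [Complex.ofReal_mul, mul_smul]
  rfl

/-- `pauliComp l` as a continuous linear function of the array of components. -/
noncomputable def pauliCompCLM (l : Fin 4) : (Fin 2 → Fin 2 → ℂ) →L[ℝ] ℝ :=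
  LinearMap.toContinuousLinearMap
    { toFun := fun Y => pauliComp l (Matrix.of Y)
      map_add' := fun Y Y' => pauliComp_add l (Matrix.of Y) (Matrix.of Y')
      map_smul' := fun x Y => pauliComp_smul l x (Matrix.of Y) }

theorem differentiableAt_tetradMatrix
    (hd : ∀ a A A', DifferentiableAt ℝ (fun y => g.tetrad y a A A') y) (b l : Fin 4) :
    DifferentiableAt ℝ (fun y => g.tetradMatrix y b l) y :=
  (pauliCompCLM l).differentiableAt.comp y
    (differentiableAt_pi.2 fun A => differentiableAt_pi.2 fun A' => hd b A A')

theorem partialDeriv_tetradMatrix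
    (hd : ∀ a A A', DifferentiableAt ℝ (fun y => g.tetrad y a A A') y) (a b l : Fin 4) :
    partialDeriv a (fun y => g.tetradMatrix y b l) y =
      pauliComp l (Matrix.of fun A A' => partialDeriv a (fun y' => g.tetrad y' b A A') y) := by
  have h := (pauliCompCLM l).hasFDerivAt.comp y
    (hasFDerivAt_pi.2 fun A => hasFDerivAt_pi.2 fun A' => (hd b A A').hasFDerivAt)
  unfold partialDeriv
  exact congrArg (fun L : Space →L[ℝ] ℝ => L (EuclideanSpace.single a 1)) h.fderiv

theorem pauliComp_spinDerivTetrad (hH : ∀ y a, (g.tetrad y a).IsHermitian)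
    (hd : ∀ a A A', DifferentiableAt ℝ (fun y => g.tetrad y a A A') y) (a b l : Fin 4) :
    pauliComp l (g.spinDerivTetrad y a b) =
      partialDeriv a (fun y => g.tetradMatrix y b l) y +
        ∑ n, frameAction (g.conn y a) l n * g.tetradMatrix y b n := by
  rw [spinDerivTetrad, add_assoc, pauliComp_add, partialDeriv_tetradMatrix hd,
    pauliComp_action _ (hH y b)]
  rfl

/-- The components `|θ| θ^a_l` of the densitised dual tetrad. -/
noncomputable def densTetrad (g : LocalGeometry) (l a : Fin 4) (y : Space) : ℝ :=
  g.vol y * (g.tetradMatrix y)⁻¹ l a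

theorem differentiableAt_densTetrad
    (hd : ∀ a A A', DifferentiableAt ℝ (fun y => g.tetrad y a A A') y)
    (hdet : (g.tetradMatrix y).det ≠ 0) (l a : Fin 4) :
    DifferentiableAt ℝ (g.densTetrad l a) y :=
  (hasFDerivAt_abs_matrix_det (differentiableAt_tetradMatrix hd) hdet).differentiableAt.mul
    (differentiableAt_matrix_inv (differentiableAt_tetradMatrix hd) hdet l a)

theorem partialDeriv_densTetrad
    (hd : ∀ a A A', DifferentiableAt ℝ (fun y => g.tetrad y a A A') y)
    (hdet : (g.tetradMatrix y).det ≠ 0) (l a c : Fin 4) :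
    partialDeriv c (g.densTetrad l a) y = g.vol y * ∑ b, ∑ m,
      ((g.tetradMatrix y)⁻¹ l a * (g.tetradMatrix y)⁻¹ m b -
        (g.tetradMatrix y)⁻¹ l b * (g.tetradMatrix y)⁻¹ m a) *
        partialDeriv c (fun y => g.tetradMatrix y b m) y := by
  have h1 := hasFDerivAt_abs_matrix_det (differentiableAt_tetradMatrix hd) hdet
  have h2 := differentiableAt_matrix_inv (differentiableAt_tetradMatrix hd) hdet l a
  have h3 := (h1.mul h2.hasFDerivAt).fderiv
  unfold partialDeriv
  refine (congrArg (fun L : Space →L[ℝ] ℝ => L (EuclideanSpace.single c 1)) h3).trans ?_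
  simp only [add_apply, smul_apply, sum_apply, smul_eq_mul,
    fderiv_matrix_inv_apply (differentiableAt_tetradMatrix hd) hdet, vol, Finset.mul_sum,
    ← Finset.sum_neg_distrib, ← Finset.sum_add_distrib]
  refine Finset.sum_congr rfl fun b _ => Finset.sum_congr rfl fun m _ => ?_
  ring

/-- The covariant divergence of the densitised dual tetrad is the torsion form. -/
theorem sum_partialDeriv_densTetrad (hH : ∀ y a, (g.tetrad y a).IsHermitian)
    (hd : ∀ a A A', DifferentiableAt ℝ (fun y => g.tetrad y a A A') y)
    (hdet : (g.tetradMatrix y).det ≠ 0)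
    (hK : ∀ a, (g.conn y a).trace + conj (g.conn y a).trace = 0) (l : Fin 4) :
    ∑ a, (partialDeriv a (g.densTetrad l a) y * minkowski l +
        ∑ n, g.vol y * ((g.tetradMatrix y)⁻¹ n a * minkowski n) *
          frameAction (g.conn y a) l n) =
      ∑ a, g.vol y * (g.torsionForm y a * ((g.tetradMatrix y)⁻¹ l a * minkowski l)) := by
  set e := (g.tetradMatrix y)⁻¹ with he
  set D := fun a b m => partialDeriv a (fun y => g.tetradMatrix y b m) y with hD
  set A := fun a => frameAction (g.conn y a) with hA
  have heθ : ∀ m n, ∑ b, e m b * g.tetradMatrix y b n = if m = n then 1 else 0 := fun m n => by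
    rw [← Matrix.mul_apply, he, Matrix.nonsing_inv_mul _ (isUnit_iff_ne_zero.2 hdet),
      Matrix.one_apply]
  have hsq := minkowski_mul_self
  -- The antisymmetry multiplied by `η_l η_n`, so that each sign carries the other index.
  have hanti : ∀ a n, minkowski n * A a l n = -(minkowski l * A a n l) := fun a n => by
    have h := minkowski_mul_frameAction (hK a) l n
    simp only [hA]
    linear_combination minkowski l * minkowski n * h -
      minkowski n * frameAction (g.conn y a) l n * hsq l +
      -minkowski l * frameAction (g.conn y a) n l * hsq n
  have hdiag : ∀ a m, A a m m = 0 := fun a m => by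
    have h := minkowski_mul_frameAction (hK a) m m
    simp only [hA]
    linear_combination minkowski m / 2 * h - frameAction (g.conn y a) m m * hsq m
  have hT : ∀ a, g.torsionForm y a =
      ∑ b, ∑ m, (D a b m - D b a m) * e m b - ∑ b, ∑ m, ∑ n,
        A b m n * g.tetradMatrix y a n * e m b := fun a => by
    -- The connection part of `Γ_a^b_b` is the trace of an element of the Lorentz Lie algebra; only
    -- that of `Γ_b^b_a` survives in `T̆_a`.
    have h1 : ∑ b, ∑ m, ∑ n, A a m n * g.tetradMatrix y b n * e m b = 0 := by
      rw [Finset.sum_comm]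
      refine Finset.sum_eq_zero fun m _ => ?_
      rw [Finset.sum_comm]
      refine Finset.sum_eq_zero fun n _ => ?_
      have h2 : ∑ b, A a m n * g.tetradMatrix y b n * e m b =
          A a m n * ∑ b, e m b * g.tetradMatrix y b n := by
        rw [Finset.mul_sum]
        exact Finset.sum_congr rfl fun b _ => by ring
      rw [h2, heθ]
      by_cases hmn : m = n
      · subst hmn
        rw [hdiag, zero_mul]
      · rw [if_neg hmn, mul_zero]
    rw [← add_zero (_ - _), ← h1]
    simp only [torsionForm, torsion, christoffel, pauliComp_spinDerivTetrad hH hd,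
      ← Finset.sum_sub_distrib, ← Finset.sum_add_distrib, ← he]
    refine Finset.sum_congr rfl fun b _ => Finset.sum_congr rfl fun m _ => ?_
    simp only [add_mul, Finset.sum_mul, hD, hA]
    ring
  have h2 : ∑ a, ∑ n, g.vol y * (e n a * minkowski n) * A a l n =
      -(g.vol y * minkowski l * ∑ b, ∑ m, A b m l * e m b) := by
    simp only [Finset.mul_sum, ← Finset.sum_neg_distrib]
    refine Finset.sum_congr rfl fun a _ => Finset.sum_congr rfl fun n _ => ?_
    linear_combination g.vol y * e n a * hanti a n
  have h3 : ∑ a, (∑ b, ∑ m, ∑ n, A b m n * g.tetradMatrix y a n * e m b) * e l a =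
      ∑ b, ∑ m, A b m l * e m b := by
    simp only [Finset.sum_mul]
    rw [Finset.sum_comm]
    refine Finset.sum_congr rfl fun b _ => ?_
    rw [Finset.sum_comm]
    refine Finset.sum_congr rfl fun m _ => ?_
    rw [Finset.sum_comm]
    have h4 : ∀ n, ∑ a, A b m n * g.tetradMatrix y a n * e m b * e l a =
        A b m n * e m b * if l = n then 1 else 0 := fun n => by
      rw [← heθ, Finset.mul_sum]
      exact Finset.sum_congr rfl fun a _ => by ring
    simp [h4]
  have h5 : ∑ a, partialDeriv a (g.densTetrad l a) y =
      g.vol y * ∑ a, (∑ b, ∑ m, (D a b m - D b a m) * e m b) * e l a := by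
    -- Exchanging `a` and `b` in the term from the derivative of the inverse is what antisymmetrises
    -- the derivative of the tetrad.
    have h6 : ∑ a, ∑ b, ∑ m, e l b * e m a * D a b m =
        ∑ a, ∑ b, ∑ m, e l a * e m b * D b a m := Finset.sum_comm
    simp only [partialDeriv_densTetrad hd hdet, ← Finset.mul_sum, ← he]
    congr 1
    simp only [sub_mul, Finset.sum_sub_distrib, Finset.sum_mul]
    refine congrArg₂ _ ?_ (h6.trans ?_) <;>
    exact Finset.sum_congr rfl fun a _ => Finset.sum_congr rfl fun b _ =>
      Finset.sum_congr rfl fun m _ => by ring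
  have h7 : ∑ a, g.torsionForm y a * e l a =
      ∑ a, (∑ b, ∑ m, (D a b m - D b a m) * e m b) * e l a - ∑ b, ∑ m, A b m l * e m b := by
    simp only [hT, sub_mul, Finset.sum_sub_distrib, h3]
  rw [Finset.sum_add_distrib, h2, ← Finset.sum_mul, h5]
  have h8 : ∑ a, g.vol y * (g.torsionForm y a * (e l a * minkowski l)) =
      g.vol y * minkowski l * ∑ a, g.torsionForm y a * e l a := by
    rw [Finset.mul_sum]
    exact Finset.sum_congr rfl fun a _ => by ring
  rw [h8, h7]
  ring

/-! ## The field equations in components -/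

/-- The components of a differentiable non-degenerate Hermitian tetrad and of a two-spinor
connection in a normalised frame, at `y`. -/
structure IsRegularAt (g : LocalGeometry) (y : Space) : Prop where
  hermitian : ∀ y a, (g.tetrad y a).IsHermitian
  differentiable : ∀ a A A', DifferentiableAt ℝ (fun y => g.tetrad y a A A') y
  det_ne_zero : (g.tetradMatrix y).det ≠ 0
  trace_conn : ∀ a, (g.conn y a).trace + conj (g.conn y a).trace = 0

variable {r : ℕ}

/-- The coordinate derivative `∂_a (|θ| γ̌^a)`, without summation over `a`. -/
noncomputable def derivDensGamma (g : LocalGeometry) (r : ℕ) (y : Space) (a : Fin 4) :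
    Model r →L[ℂ] Model r :=
  ∑ l, ((partialDeriv a (g.densTetrad l a) y * minkowski l : ℝ) : ℂ) • gammaCheck (r := r) (pauliFrame l)

theorem vol_mul_gammaUp (hH : ∀ y a, (g.tetrad y a).IsHermitian)
    (hdet : (g.tetradMatrix y).det ≠ 0) (a : Fin 4) (w : Model r) (wb : ModelDual r) :
    (g.vol y : ℂ) * wb (g.gammaUp y a w) =
      ∑ l, (g.densTetrad l a y : ℂ) * ((minkowski l : ℂ) * wb (gammaCheck (pauliFrame l) w)) := by
  rw [gammaUp_eq hH hdet, map_sum, Finset.mul_sum]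
  refine Finset.sum_congr rfl fun l _ => ?_
  rw [map_smul, densTetrad, smul_eq_mul]
  push_cast
  ring

/-- The fields are differentiable over `ℝ` only, while the pairing is complex linear; hence the
restriction of scalars before the product rule. -/
theorem partialDeriv_dual_apply {ψ : Space → Model r} {ψb : Space → ModelDual r}
    (hψ : DifferentiableAt ℝ ψ y) (hψb : DifferentiableAt ℝ ψb y)
    (B : Model r →L[ℂ] Model r) :
    DifferentiableAt ℝ (fun y => ψb y (B (ψ y))) y ∧
    ∀ a, partialDeriv a (fun y => ψb y (B (ψ y))) y =
      ψb y (B (partialDeriv a ψ y)) + partialDeriv a ψb y (B (ψ y)) := by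
  have h1 := (ContinuousLinearMap.restrictScalarsL ℂ (Model r) ℂ ℝ ℝ).hasFDerivAt.comp y
    hψb.hasFDerivAt
  have h2 := (B.restrictScalars ℝ).hasFDerivAt.comp y hψ.hasFDerivAt
  have h3 := h1.clm_apply h2
  refine ⟨h3.differentiableAt, fun a => ?_⟩
  exact congrArg (fun L : Space →L[ℝ] ℂ => L (EuclideanSpace.single a 1)) h3.fderiv

theorem partialDeriv_vol_mul_gammaUp (hg : g.IsRegularAt y) {ψ : Space → Model r}
    {ψb : Space → ModelDual r} (hψ : DifferentiableAt ℝ ψ y) (hψb : DifferentiableAt ℝ ψb y)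
    (a : Fin 4) :
    partialDeriv a (fun y => (g.vol y : ℂ) * ψb y (g.gammaUp y a (ψ y))) y =
      ψb y (g.derivDensGamma r y a (ψ y)) +
        (g.vol y : ℂ) * (ψb y (g.gammaUp y a (partialDeriv a ψ y)) +
          partialDeriv a ψb y (g.gammaUp y a (ψ y))) := by
  have hev : ∀ᶠ y' in nhds y, (g.tetradMatrix y').det ≠ 0 :=
    (hasFDerivAt_matrix_det fun b l =>
      (differentiableAt_tetradMatrix hg.differentiable b l).hasFDerivAt).continuousAt.eventually_ne
        hg.det_ne_zero
  -- Non-degeneracy is an open condition, so the Pauli expansion may be differentiated.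
  have heq : (fun y => (g.vol y : ℂ) * ψb y (g.gammaUp y a (ψ y))) =ᶠ[nhds y] fun y =>
      ∑ l, (g.densTetrad l a y : ℂ) *
        ((minkowski l : ℂ) * ψb y (gammaCheck (pauliFrame l) (ψ y))) := by
    filter_upwards [hev] with y' hy'
    exact vol_mul_gammaUp hg.hermitian hy' a _ _
  rw [partialDeriv_congr heq]
  have hf : ∀ l, HasFDerivAt (fun y => (g.densTetrad l a y : ℂ))
      (Complex.ofRealCLM.comp (fderiv ℝ (g.densTetrad l a) y)) y := fun l =>
    Complex.ofRealCLM.hasFDerivAt.comp y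
      (differentiableAt_densTetrad hg.differentiable hg.det_ne_zero l a).hasFDerivAt
  have hB := fun l => partialDeriv_dual_apply hψ hψb (gammaCheck (r := r) (pauliFrame l))
  have hm := fun l => (hf l).mul ((hB l).1.hasFDerivAt.const_mul (minkowski l : ℂ))
  have hs := HasFDerivAt.fun_sum (u := Finset.univ) fun l _ => hm l
  refine (congrArg (fun L : Space →L[ℝ] ℂ => L (EuclideanSpace.single a 1)) hs.fderiv).trans ?_
  rw [mul_add, vol_mul_gammaUp hg.hermitian hg.det_ne_zero,
    vol_mul_gammaUp hg.hermitian hg.det_ne_zero, derivDensGamma, sum_apply, sum_apply, map_sum,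
    ← Finset.sum_add_distrib, ← Finset.sum_add_distrib]
  refine Finset.sum_congr rfl fun l _ => ?_
  have hl := (hB l).2 a
  unfold partialDeriv at hl
  simp only [add_apply, smul_apply, smul_eq_mul, map_smul, hl, partialDeriv,
    ContinuousLinearMap.comp_apply, Complex.ofRealCLM_apply]
  push_cast
  ring

/-- The covariant divergence of `|θ| γ̌^a` is `|θ| γ̌[T̆]`. -/
theorem sum_derivDensGamma (hg : g.IsRegularAt y) (w : Model r) :
    ∑ a, (g.derivDensGamma r y a w + (g.vol y : ℂ) •
      (act (g.conn y a) (g.gammaUp y a w) - g.gammaUp y a (act (g.conn y a) w))) =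
      (g.vol y : ℂ) • g.gammaTorsion y w := by
  have h1 : ∀ a, act (g.conn y a) (g.gammaUp y a w) - g.gammaUp y a (act (g.conn y a) w) =
      ∑ l, ((∑ n, (g.tetradMatrix y)⁻¹ n a * minkowski n * frameAction (g.conn y a) l n : ℝ) : ℂ) •
        gammaCheck (pauliFrame l) w := fun a => by
    rw [gammaUp_eq hg.hermitian hg.det_ne_zero, gammaUp_eq hg.hermitian hg.det_ne_zero, map_sum,
      ← Finset.sum_sub_distrib]
    simp only [map_smul, ← smul_sub, act_gammaCheck_pauliFrame_sub (hg.trace_conn a),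
      Finset.smul_sum, Complex.ofReal_sum, Finset.sum_smul, smul_smul]
    rw [Finset.sum_comm]
    exact Finset.sum_congr rfl fun l _ => Finset.sum_congr rfl fun n _ => by
      rw [← Complex.ofReal_mul]
  have h2 : ∀ a, g.derivDensGamma r y a w + (g.vol y : ℂ) •
      (act (g.conn y a) (g.gammaUp y a w) - g.gammaUp y a (act (g.conn y a) w)) =
      ∑ l, ((partialDeriv a (g.densTetrad l a) y * minkowski l +
        ∑ n, g.vol y * ((g.tetradMatrix y)⁻¹ n a * minkowski n) *
          frameAction (g.conn y a) l n : ℝ) : ℂ) • gammaCheck (pauliFrame l) w := fun a => by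
    rw [h1, derivDensGamma, sum_apply, Finset.smul_sum, ← Finset.sum_add_distrib]
    refine Finset.sum_congr rfl fun l _ => ?_
    rw [smul_apply, smul_smul, ← add_smul, ← Complex.ofReal_mul, ← Complex.ofReal_add,
      Finset.mul_sum]
    simp only [mul_assoc]
  simp only [h2]
  rw [Finset.sum_comm]
  have h3 : g.gammaTorsion y w = ∑ l, ((∑ a, g.torsionForm y a *
      ((g.tetradMatrix y)⁻¹ l a * minkowski l) : ℝ) : ℂ) • gammaCheck (pauliFrame l) w := by
    rw [gammaTorsion, sum_apply]
    simp only [smul_apply, gammaUp_eq hg.hermitian hg.det_ne_zero, Finset.smul_sum,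
      Complex.ofReal_sum, Finset.sum_smul, smul_smul]
    rw [Finset.sum_comm]
    exact Finset.sum_congr rfl fun l _ => Finset.sum_congr rfl fun a _ => by
      rw [← Complex.ofReal_mul]
  rw [h3, Finset.smul_sum]
  refine Finset.sum_congr rfl fun l _ => ?_
  rw [← Finset.sum_smul, ← Complex.ofReal_sum,
    sum_partialDeriv_densTetrad hg.hermitian hg.differentiable hg.det_ne_zero hg.trace_conn,
    smul_smul, ← Complex.ofReal_mul, Finset.mul_sum]

/-! ## The derivatives of the Lagrangian density -/

/-- Each momentum below is obtained by exhibiting the linear and the constant part of the density in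
one argument. -/
theorem fderiv_clm_add_const {F : Type*} [NormedAddCommGroup F] [NormedSpace ℂ F] {f : F → ℂ}
    (L : F →L[ℂ] ℂ) (z : ℂ) (h : ∀ x, f x = L x + z) (x : F) : fderiv ℂ f x = L := by
  rw [show f = fun x => L x + z from funext h]
  simp

variable (g y) (m : ℝ) (ψ : Space → Model r) (ψb : Space → ModelDual r)

theorem momentum₀_eq :
    g.momentum₀ m ψ ψb y =
      (g.vol y : ℂ) • (-((Complex.I / 2) • g.dslashDual ψb y) - (m : ℂ) • ψb y) := by
  refine fderiv_clm_add_const _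
    ((g.vol y : ℂ) * (Complex.I / 2 * ψb y (∑ a, g.gammaUp y a (g.nabla ψ y a)))) (fun w => ?_) _
  simp only [density, dslashDual, smul_apply, sub_apply, neg_apply, smul_eq_mul]
  ring

set_option synthInstance.maxHeartbeats 200000 in
theorem momentumDual₀_apply (ηb : ModelDual r) :
    g.momentumDual₀ m ψ ψb y ηb =
      (g.vol y : ℂ) * ηb ((Complex.I / 2) • g.dslash ψ y - (m : ℂ) • ψ y) := by
  rw [momentumDual₀, fderiv_clm_add_const
    ((g.vol y : ℂ) • ContinuousLinearMap.apply ℂ ℂ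
      ((Complex.I / 2) • g.dslash ψ y - (m : ℂ) • ψ y))
    (-((g.vol y : ℂ) * (Complex.I / 2 * g.dslashDual ψb y (ψ y)))) (fun wb => ?_)]
  · rfl
  · rw [smul_apply, ContinuousLinearMap.apply_apply]
    simp only [density, dslash, dslashDual, map_sub, map_smul, smul_eq_mul]
    ring

set_option synthInstance.maxHeartbeats 200000 in
theorem momentum₁_eq (a : Fin 4) :
    g.momentum₁ m ψ ψb y a =
      (Complex.I / 2 * (g.vol y : ℂ)) • (ψb y).comp (g.gammaUp y a) := by
  rw [momentum₁, fderiv_clm_add_const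
    (∑ b, (Complex.I / 2 * (g.vol y : ℂ)) •
      ((ψb y).comp (g.gammaUp y b)).comp (ContinuousLinearMap.proj b))
    ((g.vol y : ℂ) * (-(Complex.I / 2) * g.dslashDual ψb y (ψ y) - m * ψb y (ψ y)))
    (fun q => ?_)]
  · ext w
    simp only [ContinuousLinearMap.comp_apply, sum_apply, smul_apply,
      ContinuousLinearMap.proj_apply, ContinuousLinearMap.single_apply]
    rw [Finset.sum_eq_single a]
    · simp
    · intro b _ hb
      simp [Pi.single_eq_of_ne hb]
    · simp
  · simp only [density, dslashDual, sum_apply, smul_apply, ContinuousLinearMap.comp_apply,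
      ContinuousLinearMap.proj_apply, map_sum, smul_eq_mul, ← Finset.mul_sum]
    ring

set_option synthInstance.maxHeartbeats 200000 in
theorem momentumDual₁_apply (a : Fin 4) (ηb : ModelDual r) :
    g.momentumDual₁ m ψ ψb y a ηb =
      -(Complex.I / 2 * (g.vol y : ℂ)) * ηb (g.gammaUp y a (ψ y)) := by
  rw [momentumDual₁, fderiv_clm_add_const
    (∑ b, (-(Complex.I / 2 * (g.vol y : ℂ))) •
      (ContinuousLinearMap.apply ℂ ℂ (g.gammaUp y b (ψ y))).comp (ContinuousLinearMap.proj b))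
    ((g.vol y : ℂ) * (Complex.I / 2 * ψb y (∑ a, g.gammaUp y a (g.nabla ψ y a)) -
      m * ψb y (ψ y)))
    (fun q => ?_)]
  · simp only [ContinuousLinearMap.comp_apply, sum_apply, smul_apply,
      ContinuousLinearMap.proj_apply, ContinuousLinearMap.single_apply]
    rw [Finset.sum_eq_single a]
    · simp
    · intro b _ hb
      simp [Pi.single_eq_of_ne hb]
    · simp
  · simp only [density, sum_apply, smul_apply, ContinuousLinearMap.comp_apply,
      ContinuousLinearMap.proj_apply, ContinuousLinearMap.apply_apply, smul_eq_mul,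
      ← Finset.mul_sum]
    ring

set_option synthInstance.maxHeartbeats 200000 in
theorem fderiv_lagrangian_velocity (w : Model r × ModelDual r)
    (p : Fin 4 → Model r × ModelDual r) (a : Fin 4) (η : Model r) (ηb : ModelDual r) :
    fderiv ℂ (fun p => g.lagrangian m y w p) p (Pi.single a (η, ηb)) =
      Complex.I / 2 * ((g.vol y : ℂ) * w.2 (g.gammaUp y a η)) -
        Complex.I / 2 * ((g.vol y : ℂ) * ηb (g.gammaUp y a w.1)) := by
  rw [fderiv_clm_add_const
    (∑ b, (Complex.I / 2 * (g.vol y : ℂ)) •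
      (((w.2.comp (g.gammaUp y b)).comp (ContinuousLinearMap.fst ℂ _ _) -
        (ContinuousLinearMap.apply ℂ ℂ (g.gammaUp y b w.1)).comp
          (ContinuousLinearMap.snd ℂ _ _)).comp (ContinuousLinearMap.proj b)))
    (g.lagrangian m y w 0) (fun p => ?_)]
  · simp only [ContinuousLinearMap.comp_apply, sum_apply, smul_apply,
      ContinuousLinearMap.proj_apply, sub_apply, ContinuousLinearMap.coe_fst',
      ContinuousLinearMap.coe_snd', ContinuousLinearMap.apply_apply, smul_eq_mul]
    rw [Finset.sum_eq_single a]
    · simp only [Pi.single_eq_same]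
      ring
    · intro b _ hb
      simp [Pi.single_eq_of_ne hb]
    · simp
  · simp only [lagrangian, density, ContinuousLinearMap.comp_apply, sum_apply, smul_apply,
      ContinuousLinearMap.proj_apply, sub_apply, ContinuousLinearMap.coe_fst',
      ContinuousLinearMap.coe_snd', ContinuousLinearMap.apply_apply, smul_eq_mul, map_sum, map_add,
      Finset.sum_add_distrib, Finset.sum_sub_distrib, ← Finset.mul_sum, Pi.zero_apply,
      Prod.fst_zero, Prod.snd_zero, zero_apply, map_zero, Finset.sum_const_zero]
    ring

set_option synthInstance.maxHeartbeats 200000 in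
theorem fderiv_lagrangian_field (w : Model r × ModelDual r)
    (p : Fin 4 → Model r × ModelDual r) (η : Model r) (ηb : ModelDual r) :
    fderiv ℂ (fun w => g.lagrangian m y w p) w (η, ηb) =
      (g.vol y : ℂ) * (Complex.I / 2 *
        (∑ a, (ηb (g.gammaUp y a ((p a).1 + act (g.conn y a) w.1)) +
            ηb (act (g.conn y a) (g.gammaUp y a w.1))) -
          ∑ a, (((p a).2 - w.2.comp (act (g.conn y a))) (g.gammaUp y a η) -
            w.2 (g.gammaUp y a (act (g.conn y a) η)))) -
        m * (ηb w.1 + w.2 η)) := by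
  -- In the pair `w` the Lagrangian is not affine: `E` collects its bilinear part, namely the mass
  -- term and the connection terms of both covariant derivatives, while `z` and `zb` collect the
  -- parts linear in `Ψ̄` and in `Ψ`.
  let E : Model r →L[ℂ] Model r := (Complex.I / 2) • ∑ a, ((g.gammaUp y a).comp (act (g.conn y a)) +
    (act (g.conn y a)).comp (g.gammaUp y a)) - (m : ℂ) • ContinuousLinearMap.id ℂ (Model r)
  let z : Model r := (Complex.I / 2) • ∑ a, g.gammaUp y a (p a).1
  let zb : ModelDual r := (Complex.I / 2) • ∑ a, (p a).2.comp (g.gammaUp y a)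
  have h : (fun w => g.lagrangian m y w p) =
      fun w => (g.vol y : ℂ) * (w.2 (E w.1 + z) - zb w.1) := by
    funext w
    simp only [lagrangian, density, E, z, zb, sum_apply, smul_apply, sub_apply, add_apply,
      ContinuousLinearMap.comp_apply, map_add, map_sub, map_smul, map_sum, smul_eq_mul,
      Finset.sum_add_distrib, Finset.sum_sub_distrib, ContinuousLinearMap.id_apply]
    ring
  have h2 := ((hasFDerivAt_snd (𝕜 := ℂ) (p := w)).clm_apply
    ((E.hasFDerivAt.comp w (hasFDerivAt_fst (𝕜 := ℂ) (p := w))).add_const z)).sub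
      (zb.hasFDerivAt.comp w (hasFDerivAt_fst (𝕜 := ℂ) (p := w)))
  have h3 := (h2.const_mul (g.vol y : ℂ)).fderiv
  rw [h]
  refine (congrArg (fun L : (Model r × ModelDual r) →L[ℂ] ℂ => L (η, ηb)) h3).trans ?_
  change (g.vol y : ℂ) * ((w.2 (E η) + ηb (E w.1 + z)) - zb η) = _
  simp only [E, z, zb, sum_apply, smul_apply, sub_apply, add_apply,
    ContinuousLinearMap.comp_apply, map_add, map_sub, map_smul, map_sum, smul_eq_mul,
    Finset.sum_add_distrib, Finset.sum_sub_distrib, ContinuousLinearMap.id_apply]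
  ring

variable {g y ψ ψb}

theorem eulerLagrange_eq (hψ : DifferentiableAt ℝ ψ y) (hψb : DifferentiableAt ℝ ψb y)
    (η : Model r) (ηb : ModelDual r) :
    eulerLagrange (g.lagrangian m) (fun y => (ψ y, ψb y)) y (η, ηb) =
      (g.vol y : ℂ) * (Complex.I / 2 *
        (∑ a, (ηb (g.gammaUp y a (g.nabla ψ y a)) +
            ηb (act (g.conn y a) (g.gammaUp y a (ψ y)))) -
          ∑ a, (g.nablaDual ψb y a (g.gammaUp y a η) -
            ψb y (g.gammaUp y a (act (g.conn y a) η)))) -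
        m * (ηb (ψ y) + ψb y η)) -
      ∑ a, partialDeriv a (fun y => Complex.I / 2 * ((g.vol y : ℂ) * ψb y (g.gammaUp y a η)) -
        Complex.I / 2 * ((g.vol y : ℂ) * ηb (g.gammaUp y a (ψ y)))) y := by
  unfold eulerLagrange
  simp only [fderiv_lagrangian_velocity, fderiv_lagrangian_field, partialDeriv_prodMk hψ hψb]
  rfl

/-- The derivative of the momentum is left unexpanded. The explicit dependence of `∇Ψ` on `Ψ`
through the connection is exactly the connection term of `d_Γ`. -/
theorem eulerLagrange_field (hψ : DifferentiableAt ℝ ψ y) (hψb : DifferentiableAt ℝ ψb y)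
    (η : Model r) :
    eulerLagrange (g.lagrangian m) (fun y => (ψ y, ψb y)) y (η, 0) =
      g.momentum₀ m ψ ψb y η - g.covDiff (g.momentum₁ m ψ ψb) y η := by
  rw [eulerLagrange_eq m hψ hψb, momentum₀_eq]
  simp only [covDiff, momentum₁_eq, dslashDual, zero_apply, mul_zero, sub_zero, zero_add, add_zero,
    Finset.sum_const_zero, smul_apply, sub_apply, neg_apply, sum_apply,
    ContinuousLinearMap.comp_apply, smul_eq_mul, Finset.sum_sub_distrib, mul_assoc,
    ← Finset.mul_sum]
  ring

theorem eulerLagrange_dual (hψ : DifferentiableAt ℝ ψ y) (hψb : DifferentiableAt ℝ ψb y)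
    (ηb : ModelDual r) :
    eulerLagrange (g.lagrangian m) (fun y => (ψ y, ψb y)) y (0, ηb) =
      g.momentumDual₀ m ψ ψb y ηb - g.covDiffDual (g.momentumDual₁ m ψ ψb) y ηb := by
  rw [eulerLagrange_eq m hψ hψb, momentumDual₀_apply]
  simp only [covDiffDual, momentumDual₁_apply, dslash, map_zero, mul_zero, sub_zero, zero_sub,
    add_zero, Finset.sum_const_zero, map_sub, map_smul, map_sum,
    ContinuousLinearMap.comp_apply, smul_eq_mul, Finset.sum_add_distrib, mul_assoc, neg_mul,
    Finset.sum_neg_distrib, ← Finset.mul_sum]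
  ring

/-- The Euler-Lagrange expression in the direction of `Ψ̄`. -/
theorem eulerLagrange_dual_eq (hg : g.IsRegularAt y) (hψ : DifferentiableAt ℝ ψ y)
    (hψb : DifferentiableAt ℝ ψb y) (ηb : ModelDual r) :
    eulerLagrange (g.lagrangian m) (fun y => (ψ y, ψb y)) y (0, ηb) =
      (g.vol y : ℂ) * ηb (Complex.I • g.dslash ψ y - (m : ℂ) • ψ y +
        (Complex.I / 2) • g.gammaTorsion y (ψ y)) := by
  have hdiv := congrArg ηb (sum_derivDensGamma hg (ψ y))
  -- The variation is treated as a constant field, so only `|θ| γ̌^a` and `ψ` are differentiated.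
  have hp := fun a => partialDeriv_vol_mul_gammaUp hg hψ (differentiableAt_const ηb) a
  simp only [partialDeriv_const, zero_apply, add_zero] at hp
  rw [eulerLagrange_eq m hψ hψb]
  simp only [map_zero, mul_zero, zero_sub, sub_zero, Finset.sum_const_zero, add_zero, ← neg_mul,
    partialDeriv_const_mul, hp]
  simp only [dslash, nabla, map_add, map_sub, map_smul, map_sum, smul_eq_mul,
    Finset.sum_add_distrib, Finset.sum_sub_distrib, mul_sub, mul_add, ← Finset.mul_sum,
    neg_mul, Finset.sum_neg_distrib] at hdiv ⊢
  linear_combination (Complex.I / 2) * hdiv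

/-- The Euler-Lagrange expression in the direction of `Ψ`. -/
theorem eulerLagrange_field_eq (hg : g.IsRegularAt y) (hψ : DifferentiableAt ℝ ψ y)
    (hψb : DifferentiableAt ℝ ψb y) (η : Model r) :
    eulerLagrange (g.lagrangian m) (fun y => (ψ y, ψb y)) y (η, 0) =
      (g.vol y : ℂ) * (-(Complex.I • g.dslashDual ψb y) - (m : ℂ) • ψb y -
        (Complex.I / 2) • (ψb y).comp (g.gammaTorsion y)) η := by
  have hdiv := congrArg (ψb y) (sum_derivDensGamma hg η)
  have hp := fun a => partialDeriv_vol_mul_gammaUp hg (differentiableAt_const η) hψb a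
  simp only [partialDeriv_const, map_zero, zero_add] at hp
  rw [eulerLagrange_eq m hψ hψb]
  simp only [zero_apply, mul_zero, zero_sub, sub_zero, zero_add, Finset.sum_const_zero, add_zero,
    partialDeriv_const_mul, hp]
  simp only [dslashDual, nablaDual, map_add, map_sub, map_smul, map_sum, smul_eq_mul, smul_apply,
    sub_apply, neg_apply, sum_apply, ContinuousLinearMap.comp_apply,
    Finset.sum_add_distrib, Finset.sum_sub_distrib, mul_sub, mul_add, ← Finset.mul_sum] at hdiv ⊢
  -- The same divergence identity as for `Ψ̄`, now tested on `η` and paired with `Ψ̄`; the opposite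
  -- sign of the torsion term comes from here.
  linear_combination (-Complex.I / 2) * hdiv

theorem energyTensor_eq (a b : Fin 4) :
    g.energyTensor m ψ ψb y a b =
      (if a = b then g.lagrangian m y (ψ y, ψb y)
          (fun e => (partialDeriv e ψ y, partialDeriv e ψb y)) else 0) -
        Complex.I / 2 * (g.vol y : ℂ) * ψb y (g.gammaUp y a (g.nabla ψ y b)) +
        Complex.I / 2 * (g.vol y : ℂ) * g.nablaDual ψb y b (g.gammaUp y a (ψ y)) := by
  rw [energyTensor, momentum₁_eq, momentumDual₁_apply, neg_mul, sub_neg_eq_add]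
  rfl

end LocalGeometry

section Bundles

/-! ## The geometry of a chart with a normalised frame -/

theorem wedge_combination_left {V : Type*} [AddCommGroup V] [Module ℂ V] (u v : V) (p q : ℂ) :
    wedge (p • u + q • v) v = p • wedge u v := by
  have h : exteriorPower.ιMulti ℂ 2 ![v, v] = 0 :=
    (exteriorPower.ιMulti ℂ 2).map_eq_zero_of_eq ![v, v] (i := 0) (j := 1) rfl (by decide)
  unfold wedge
  rw [AlternatingMap.map_vecCons_add, AlternatingMap.map_vecCons_smul,
    AlternatingMap.map_vecCons_smul, h, smul_zero, add_zero]

theorem wedge_swap {V : Type*} [AddCommGroup V] [Module ℂ V] (u v : V) :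
    wedge v u = -wedge u v := by
  have h := (exteriorPower.ιMulti ℂ 2).map_swap ![u, v] (i := 0) (j := 1) (by decide)
  unfold wedge
  rw [← h]
  congr 1
  funext i
  fin_cases i <;> rfl

theorem wedge_combination_right {V : Type*} [AddCommGroup V] [Module ℂ V] (u v : V) (p q : ℂ) :
    wedge u (p • u + q • v) = q • wedge u v := by
  rw [wedge_swap, add_comm, wedge_combination_left, wedge_swap u v, smul_neg, neg_neg]

variable {M : Type*} [TopologicalSpace M] [ChartedSpace Space M]
  {U : M → Type*} [∀ x, AddCommGroup (U x)] [∀ x, Module ℂ (U x)]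
  [∀ x, TopologicalSpace (U x)] [TopologicalSpace (TotalSpace (Fin 2 → ℂ) U)]
  [FiberBundle (Fin 2 → ℂ) U]

theorem SpinorChart.mdifferentiable (c : SpinorChart U) :
    c.chart.MDifferentiable 𝓘(ℝ, Space) 𝓘(ℝ, Space) :=
  ⟨(contMDiffOn_of_mem_maximalAtlas c.chart_mem).mdifferentiableOn (by simp),
    (contMDiffOn_symm_of_mem_maximalAtlas c.chart_mem).mdifferentiableOn (by simp)⟩

theorem SpinorChart.eq_zero_of_sum_smul_coordVector (c : SpinorChart U) {y : Space}
    (hy : y ∈ c.chart.target) {v : Fin 4 → ℝ} (hv : ∑ a, v a • c.coordVector y a = 0) :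
    v = 0 := by
  have hinj := c.mdifferentiable.symm.mfderiv_injective hy
  have h : mfderiv 𝓘(ℝ, Space) 𝓘(ℝ, Space) c.chart.symm y
      (∑ a, v a • (EuclideanSpace.single a (1 : ℝ) : Space) : Space) = 0 := by
    rw [← hv]
    refine (map_sum (mfderiv 𝓘(ℝ, Space) 𝓘(ℝ, Space) c.chart.symm y) _ _).trans ?_
    exact Finset.sum_congr rfl fun a _ => map_smul _ _ _
  have h0 : (∑ a, v a • (EuclideanSpace.single a (1 : ℝ) : Space) : Space) = 0 :=
    hinj (h.trans (map_zero _).symm)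
  funext b
  have hb := congrArg (fun w : Space => w b) h0
  simpa [PiLp.single_apply, Pi.single_apply] using hb

variable [∀ x, Module ℝ (U x)] [∀ x, IsTopologicalAddGroup (U x)] [∀ x, ContinuousSMul ℝ (U x)]
  {S : SpinorStructure U}

theorem SpinorChart.isHermitian_tetrad (c : SpinorChart U) (th : Tetrad U)
    (nab : SpinorConnection S) (y : Space) (a : Fin 4) :
    ((c.geometry th nab).tetrad y a).IsHermitian := by
  ext A A'
  exact (th.hermitian _ _ _ _).symm

/-- A null vector `v` of the matrix makes the Hermitian element `∑ v^a θ_a` vanish in the Pauli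
frame, hence altogether. Injectivity of the tetrad and independence of the coordinate vectors then
give `v = 0`. -/
theorem SpinorChart.det_tetradMatrix_ne_zero (c : SpinorChart U) (th : Tetrad U)
    (nab : SpinorConnection S) {y : Space} (hy : y ∈ c.chart.target) :
    ((c.geometry th nab).tetradMatrix y).det ≠ 0 := by
  intro hdet
  obtain ⟨v, hv0, hv⟩ := Matrix.exists_vecMul_eq_zero_iff.2 hdet
  refine hv0 (c.eq_zero_of_sum_smul_coordVector hy (th.injective _ ?_))
  rw [map_zero]
  set Y : Mat2 := ∑ a, (v a : ℂ) • (c.geometry th nab).tetrad y a with hY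
  have hH : Y.IsHermitian := by
    unfold Matrix.IsHermitian
    rw [hY, Matrix.conjTranspose_sum]
    refine Finset.sum_congr rfl fun a _ => ?_
    rw [Matrix.conjTranspose_smul, (c.isHermitian_tetrad th nab y a).eq]
    simp
  have hY0 : Y = 0 := by
    rw [← sum_pauliComp_smul_pauliFrame hH]
    refine Finset.sum_eq_zero fun l _ => ?_
    have h : pauliComp l Y = 0 := by
      change pauliCompL l Y = 0
      rw [hY, map_sum]
      refine Eq.trans ?_ (congrFun hv l)
      exact Finset.sum_congr rfl fun a _ => pauliComp_smul l (v a) _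
    rw [h, Complex.ofReal_zero, zero_smul]
  refine (c.frame (c.chart.symm y)).dualBasis.ext fun A =>
    (c.frame (c.chart.symm y)).dualBasis.ext fun A' => ?_
  have h := congrFun (congrFun hY0 A) A'
  rw [hY, Matrix.sum_apply] at h
  rw [map_sum, LinearMap.sum_apply, LinearMap.sum_apply]
  simp only [map_smul, LinearMap.smul_apply, Module.Basis.coe_dualBasis]
  exact h

/-- Differentiate `‖z_1 ∧ z_2‖² = 1`: the induced connection on `Λ²U` multiplies `z_1 ∧ z_2` by the
trace. -/
theorem SpinorChart.trace_conn (c : SpinorChart U) (th : Tetrad U) (nab : SpinorConnection S)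
    (hc : S.IsNormalised c) {y : Space} (hy : y ∈ c.chart.target) (a : Fin 4) :
    ((c.geometry th nab).conn y a).trace + conj ((c.geometry th nab).conn y a).trace = 0 := by
  set x := c.chart.symm y with hx
  have hxs : x ∈ c.chart.source := c.chart.map_target hy
  have hnhds := c.chart.open_source.mem_nhds hxs
  set K := (c.geometry th nab).conn y a with hK
  have hcov : ∀ B, nab.cov (fun x => c.frame x B) x (c.coordVector y a) =
      K 0 B • c.frame x 0 + K 1 B • c.frame x 1 := fun B => by
    rw [← (c.frame x).sum_repr (nab.cov (fun x => c.frame x B) x (c.coordVector y a)),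
      Fin.sum_univ_two]
    rfl
  have h := nab.preserves (fun i x => c.frame x (![0, 1, 0, 1] i)) x
    (fun i => ((c.frame_smooth _).contMDiffAt hnhds).mdifferentiableAt (by simp))
    (c.coordVector y a)
  have hconst : (fun x => S.form x (wedge (c.frame x 0) (c.frame x 1))
      (wedge (c.frame x 0) (c.frame x 1))) =ᶠ[nhds x] fun _ => 1 :=
    Filter.eventually_of_mem hnhds hc
  have h0 : mfderiv 𝓘(ℝ, Space) 𝓘(ℝ, ℂ) (fun x => S.form x (wedge (c.frame x 0) (c.frame x 1))
      (wedge (c.frame x 0) (c.frame x 1))) x = 0 :=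
    hconst.mfderiv_eq.trans mfderiv_const
  have h1 := (congrArg (fun L => L (c.coordVector y a)) h0).symm.trans h
  have hw : wedge (nab.cov (fun x => c.frame x 0) x (c.coordVector y a)) (c.frame x 1) +
      wedge (c.frame x 0) (nab.cov (fun x => c.frame x 1) x (c.coordVector y a)) =
      K.trace • wedge (c.frame x 0) (c.frame x 1) := by
    rw [hcov, hcov, wedge_combination_left, wedge_combination_right, ← add_smul,
      Matrix.trace_fin_two]
  have h2 : (0 : ℂ) = S.form x (K.trace • wedge (c.frame x 0) (c.frame x 1))
        (wedge (c.frame x 0) (c.frame x 1)) +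
      S.form x (wedge (c.frame x 0) (c.frame x 1))
        (K.trace • wedge (c.frame x 0) (c.frame x 1)) := by
    rw [← hw]
    exact h1
  -- The form is conjugate linear in its first argument, so the first term yields the conjugate of
  -- the trace.
  rw [map_smulₛₗ, map_smulₛₗ, LinearMap.smul_apply, hc x hxs] at h2
  simp only [smul_eq_mul, mul_one, RingHom.id_apply] at h2
  rw [add_comm, ← h2]

theorem SpinorChart.isRegularAt (c : SpinorChart U) (th : Tetrad U) (nab : SpinorConnection S)
    (hc : S.IsNormalised c) {y : Space} (hy : y ∈ c.chart.target) :
    (c.geometry th nab).IsRegularAt y where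
  hermitian := c.isHermitian_tetrad th nab
  differentiable a A A' := ((th.smooth c a A A').contDiffAt
    (c.chart.open_target.mem_nhds hy)).differentiableAt (by simp)
  det_ne_zero := c.det_tetradMatrix_ne_zero th nab hy
  trace_conn := c.trace_conn th nab hc hy

end Bundles

/-! ### From vanishing variations to field equations -/

theorem forall_dual_apply_eq_zero_iff {r : ℕ} {z : ℂ} (hz : z ≠ 0) (w : Model r) :
    (∀ ηb : ModelDual r, z * ηb w = 0) ↔ w = 0 := by
  refine ⟨fun h => ?_, fun h ηb => by rw [h, map_zero, mul_zero]⟩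
  by_contra hw
  obtain ⟨f, hf⟩ := SeparatingDual.exists_ne_zero (R := ℂ) hw
  exact hf ((mul_eq_zero.1 (h f)).resolve_left hz)

theorem forall_apply_eq_zero_iff {r : ℕ} {z : ℂ} (hz : z ≠ 0) (wb : ModelDual r) :
    (∀ η : Model r, z * wb η = 0) ↔ wb = 0 :=
  ⟨fun h => ContinuousLinearMap.ext fun η => (mul_eq_zero.1 (h η)).resolve_left hz,
    fun h η => by rw [h, zero_apply, mul_zero]⟩

end HigherSpin

open HigherSpin in
theorem mainTheorem6
    {M : Type*} [TopologicalSpace M] [ChartedSpace Space M] [IsManifold 𝓘(ℝ, Space) ∞ M]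
    {U : M → Type*} [∀ x, AddCommGroup (U x)] [∀ x, Module ℂ (U x)] [∀ x, Module ℝ (U x)]
    [∀ x, IsScalarTower ℝ ℂ (U x)] [∀ x, TopologicalSpace (U x)]
    [∀ x, IsTopologicalAddGroup (U x)] [∀ x, ContinuousSMul ℝ (U x)]
    [TopologicalSpace (TotalSpace (Fin 2 → ℂ) U)] [FiberBundle (Fin 2 → ℂ) U]
    [VectorBundle ℝ (Fin 2 → ℂ) U] [VectorBundle ℂ (Fin 2 → ℂ) U]
    [ContMDiffVectorBundle ∞ (Fin 2 → ℂ) U 𝓘(ℝ, Space)]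
    (S : SpinorStructure U) (th : Tetrad U) (nab : SpinorConnection S)
    (r : ℕ) (hr : 1 ≤ r) (m : ℝ)
    (Ψ : ∀ x, HigherSpinor (U x) r)
    (hΨ : ∀ c : SpinorChart U, ContDiffOn ℝ ∞ (c.field Ψ) c.chart.target)
    (Ψb : ∀ x, DualHigherSpinor (U x) r)
    (hΨb : ∀ c : SpinorChart U, ContDiffOn ℝ ∞ (c.dualField Ψb) c.chart.target)
    (c : SpinorChart U) (hc : S.IsNormalised c) (y : Space) (hy : y ∈ c.chart.target) :
    let g := c.geometry th nab
    let ψ := c.field Ψ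
    let ψb := c.dualField Ψb
    let EL := eulerLagrange (g.lagrangian m) (fun y => (ψ y, ψb y)) y
    -- the field equations of the pair `(Ψ, Ψ̄)`
    ((∀ ηb, EL (0, ηb) = 0) ↔
      Complex.I • g.dslash ψ y - (m : ℂ) • ψ y +
        (Complex.I / 2) • g.gammaTorsion y (ψ y) = 0) ∧
    ((∀ η, EL (η, 0) = 0) ↔
      -(Complex.I • g.dslashDual ψb y) - (m : ℂ) • ψb y -
        (Complex.I / 2) • (ψb y).comp (g.gammaTorsion y) = 0) ∧
    -- their expression by covariant differentials
    (∀ η, EL (η, 0) = g.momentum₀ m ψ ψb y η - g.covDiff (g.momentum₁ m ψ ψb) y η) ∧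
    (∀ ηb, EL (0, ηb) =
      g.momentumDual₀ m ψ ψb y ηb - g.covDiffDual (g.momentumDual₁ m ψ ψb) y ηb) ∧
    g.momentum₀ m ψ ψb y =
      (g.vol y : ℂ) • (-((Complex.I / 2) • g.dslashDual ψb y) - (m : ℂ) • ψb y) ∧
    (∀ ηb, g.momentumDual₀ m ψ ψb y ηb =
      (g.vol y : ℂ) * ηb ((Complex.I / 2) • g.dslash ψ y - (m : ℂ) • ψ y)) ∧
    (∀ a, g.momentum₁ m ψ ψb y a =
      (Complex.I / 2 * (g.vol y : ℂ)) • (ψb y).comp (g.gammaUp y a)) ∧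
    (∀ a ηb, g.momentumDual₁ m ψ ψb y a ηb =
      -(Complex.I / 2 * (g.vol y : ℂ)) * ηb (g.gammaUp y a (ψ y))) ∧
    -- the canonical energy tensor
    (∀ a b, g.energyTensor m ψ ψb y a b =
      (if a = b then g.lagrangian m y (ψ y, ψb y)
          (fun e => (partialDeriv e ψ y, partialDeriv e ψb y)) else 0) -
        Complex.I / 2 * (g.vol y : ℂ) * ψb y (g.gammaUp y a (g.nabla ψ y b)) +
        Complex.I / 2 * (g.vol y : ℂ) * g.nablaDual ψb y b (g.gammaUp y a (ψ y))) := by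
  intro g ψ ψb EL
  have hn := c.chart.open_target.mem_nhds hy
  have hψ : DifferentiableAt ℝ ψ y := ((hΨ c).contDiffAt hn).differentiableAt (by simp)
  have hψb : DifferentiableAt ℝ ψb y := ((hΨb c).contDiffAt hn).differentiableAt (by simp)
  have hg : g.IsRegularAt y := c.isRegularAt th nab hc hy
  -- Both Euler-Lagrange expressions carry the factor `|θ|`; its non-vanishing makes them equivalent
  -- to the stated equations.
  have hvol : (g.vol y : ℂ) ≠ 0 := Complex.ofReal_ne_zero.2 (abs_ne_zero.2 hg.det_ne_zero)
  refine ⟨?_, ?_, LocalGeometry.eulerLagrange_field m hψ hψb,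
    LocalGeometry.eulerLagrange_dual m hψ hψb, LocalGeometry.momentum₀_eq g y m ψ ψb,
    LocalGeometry.momentumDual₀_apply g y m ψ ψb, LocalGeometry.momentum₁_eq g y m ψ ψb,
    LocalGeometry.momentumDual₁_apply g y m ψ ψb, LocalGeometry.energyTensor_eq m⟩
  · simp only [EL, LocalGeometry.eulerLagrange_dual_eq m hg hψ hψb]
    exact forall_dual_apply_eq_zero_iff hvol _
  · simp only [EL, LocalGeometry.eulerLagrange_field_eq m hg hψ hψb]
    exact forall_apply_eq_zero_iff hvol _
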